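/- **Setting.** Let $N\in\mathbb N$ be the number of days, $\emptyset\ne\mathcal N\subset\{1,\dots,N-1\}$, and $Q,\delta t,\sigma,\gamma>0$, $S_0\in\mathbb R$. On a filtered probability space $(\Omega,(\mathcal F_n)_n,\mathbb P)$ let $\epsilon_1,\dots,\epsilon_N$ be i.i.d. with mean $0$, variance $1$ and $\mathbb E[e^{t\epsilon_1}]<\infty$ for all $t\ge0$, where $\epsilon_{n+1}$ is $\mathcal F_{n+1}$-measurable and independent of $\mathcal F_n$. The market volumes $V_n>0$ ($1\le n\le N$) are $\mathcal F_0$-measurable. The function $L\in C(\mathbb R,\mathbb R_+)$ is even, strictly convex, nondecreasing on $\mathbb R_+$, with $L(0)=0$ and $L(\rho)/\rho\to+\infty$ as $\rho\to+\infty$; the function $\ell:\mathbb R\to\mathbb R$ is even, convex, nondecreasing on $\mathbb R_+$, with $\ell(0)=0$. For $0\le n\le N$ let $\mathcal A_n$ be the set of pairs $(v,n^\star)$ where $v=(v_k)_{n\le k<n^\star}$ is adapted and real-valued and $n^\star$ is a stopping time with values in $(\mathcal N\cup\{N\})\cap\{n,\dots,N\}$. Starting at time $n$ from $(x,q,S,A)$,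 put for $n\le k\le N$, $k\geq 1$, $$S_k=S+\sigma\sqrt{\delta t}\sum_{j=n}^{k-1}\epsilon_{j+1},\qquad A_k=\frac nk A+\frac1k\sum_{j=n}^{k-1}S_{j+1},\qquad q_k=q-\sum_{j=n}^{k-1}v_j\delta t,$$ $$X_k=x+\sum_{j=n}^{k-1}\Big(v_jS_{j+1}\delta t+L\Big(\frac{v_j}{V_{j+1}}\Big)V_{j+1}\delta t\Big),\qquad Z_k=\frac{S_k-A_k}{\sigma\sqrt{\delta t}}$$ (and $q_0=q$ if $n=0$). The bank maximises over $\mathcal A_n$ the expected utility, with values in $[-\infty,0]$, $$J_n(v,n^\star)=\mathbb E\big[-\exp\big(-\gamma(QA_{n^\star}-X_{n^\star}-q_{n^\star}S_{n^\star}-\ell(q_{n^\star}))\big)\big].$$ The problem at inception is that with $n=0$, $x=0$, $q=Q$, $S=S_0$ (then $A$ plays no role). For a fixed positive volume curve $w=(w_1,\dots,w_N)$ define, for $1\le n\le N$ and $q,Z\in\mathbb R$, with values in $[-\infty,+\infty]$, $$\theta^w_n(q,Z)=\inf_{(v,n^\star)\in\mathcal A_n}\frac1\gamma\log\mathbb E\Big[\exp\Big(\gamma\Big(\sigma\sqrt{\delta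 t}\Big(\sum_{j=n}^{n^\star-1}\Big(q_j-\Big(1-\frac j{n^\star}\Big)Q\Big)\epsilon_{j+1}-\Big(1-\frac n{n^\star}\Big)QZ\Big)+\sum_{j=n}^{n^\star-1}L\Big(\frac{v_j}{w_{j+1}}\Big)w_{j+1}\delta t+\ell(q_{n^\star})\Big)\Big)\Big]$$ with $q_j=q-\sum_{i=n}^{j-1}v_i\delta t$ and, for $1\le n<N$ and $v\in\mathbb R$, $$J^w_n(q,Z;v)=\frac1\gamma\log\mathbb E\Big[\exp\Big(\gamma\Big(\sigma\sqrt{\delta t}\Big(\Big(q-\frac Q{n+1}\Big)\epsilon_{n+1}-\frac Q{n+1}Z\Big)+L\Big(\frac v{w_{n+1}}\Big)w_{n+1}\delta t+\theta^w_{n+1}\Big(q-v\delta t,\frac n{n+1}(Z+\epsilon_{n+1})\Big)\Big)\Big)\Big],$$ $$\tilde\theta^w_{n,n+1}(q,Z)=\inf_{v\in\mathbb R}J^w_n(q,Z;v).$$ As the volumes are known at time $0$, write $\theta_n$, $J_n(\cdot,\cdot;\cdot)$, $\tilde\theta_{n,n+1}$ for these functions at $w=(V_1,\dots,V_N)$.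 **The prescription.** - (At time $0$.) Send an order of size $v^*\delta t$ with $v^*\in\arg\min_{v\in\mathbb R}\big\{L(v/V_1)V_1\delta t+\theta_1(Q-v\delta t,0)\big\}$. - (At a time $k$ with $1\le k<N$, if the shares have not been delivered before.) If $k\in\mathcal N$ and $\ell(q_k)\le\tilde\theta_{k,k+1}(q_k,Z_k)$, deliver. Otherwise (that is, if $k\notin\mathcal N$, or $k\in\mathcal N$ and $\tilde\theta_{k,k+1}(q_k,Z_k)<\ell(q_k)$) do not deliver and send an order of size $v^*\delta t$ with $v^*\in\arg\min_{v\in\mathbb R}J_k(q_k,Z_k;v)$. - (At time $N$.) Deliver, if the shares have not been delivered before. **Proposition (optimal strategy, temporary impact).** 1. There is a strategy in $\mathcal A_0$ that obeys the prescription at all times $0,1,\dots$ until delivery, and every strategy in $\mathcal A_0$ that almost surely obeys it is optimal for the problem at inception. 2. For every $1\le n<N$ and every $(x,q,S,A)\in\mathbb R^4$, there is a strategy in $\mathcal A_n$ that obeys the prescription at all times $n,n+1,\dots$ until delivery, and every strategy in $\mathcal A_n$ that almost surely obeys it maximises $J_n$ over $\mathcal A_n$ for the problem started from $(x,q,S,A)$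 at time $n$. -/

import Mathlib

open MeasureTheory ProbabilityTheory Filter
open scoped ENNReal Topology

noncomputable section

/-- The model with temporary market impact: contract parameters, cost functions, noise and
market volumes on a filtered probability space. Only the indices `1, …, N` of `ε` matter, and only
the indices `1, …, N` of `V`. -/
structure ASRModel {Ω : Type*} [mΩ : MeasurableSpace Ω] (P : Measure Ω) where
  /-- number of days -/
  N : ℕ
  /-- dates, other than the final one, at which delivery is allowed -/
  deliveryDates : Finset ℕ
  deliveryDates_nonempty : deliveryDates.Nonempty
  deliveryDates_mem : ∀ n ∈ deliveryDates, 1 ≤ n ∧ n < N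
  /-- number of shares of the contract -/
  Q : ℝ
  Q_pos : 0 < Q
  /-- length of a day -/
  δt : ℝ
  δt_pos : 0 < δt
  /-- volatility -/
  σ : ℝ
  σ_pos : 0 < σ
  /-- absolute risk aversion -/
  γ : ℝ
  γ_pos : 0 < γ
  /-- initial price -/
  S₀ : ℝ
  /-- execution cost function -/
  L : ℝ → ℝ
  L_cont : Continuous L
  L_nonneg : ∀ ρ, 0 ≤ L ρ
  L_zero : L 0 = 0
  L_even : ∀ ρ, L (-ρ) = L ρ
  L_mono : MonotoneOn L (Set.Ici 0)
  L_strictConvex : StrictConvexOn ℝ Set.univ L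
  L_superlinear : Tendsto (fun ρ => L ρ / ρ) atTop atTop
  /-- penalty function at delivery -/
  ell : ℝ → ℝ
  ell_convex : ConvexOn ℝ Set.univ ell
  ell_even : ∀ q, ell (-q) = ell q
  ell_mono : MonotoneOn ell (Set.Ici 0)
  ell_zero : ell 0 = 0
  /-- the filtration -/
  ℱ : Filtration ℕ mΩ
  /-- the price innovations -/
  ε : ℕ → Ω → ℝ
  ε_adapted : ∀ n, n < N → Measurable[ℱ (n + 1)] (ε (n + 1))
  ε_indep_past : ∀ n, n < N →
    Indep (MeasurableSpace.comap (ε (n + 1)) inferInstance) (ℱ n) P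
  ε_indep : iIndepFun (fun (n : Finset.Icc 1 N) => ε n) P
  ε_identDistrib : ∀ m ∈ Finset.Icc 1 N, ∀ n ∈ Finset.Icc 1 N, IdentDistrib (ε m) (ε n) P P
  ε_memLp : ∀ n ∈ Finset.Icc 1 N, MemLp (ε n) 2 P
  ε_mean : ∀ n ∈ Finset.Icc 1 N, P[ε n] = 0
  ε_variance : ∀ n ∈ Finset.Icc 1 N, Var[ε n; P] = 1
  ε_mgf : ∀ n ∈ Finset.Icc 1 N, ∀ t : ℝ, 0 ≤ t → Integrable (fun ω => Real.exp (t * ε n ω)) P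
  /-- the market volume traded on day `n` is `V n * δt` -/
  V : ℕ → Ω → ℝ
  V_measurable : ∀ n, Measurable[ℱ 0] (V n)
  V_pos : ∀ n ω, 0 < V n ω

/-- A trading rate process together with a delivery date. The rates `v k ω` with
`nstar ω ≤ k` are never used. -/
structure ASRStrategy (Ω : Type*) where
  v : ℕ → Ω → ℝ
  nstar : Ω → ℕ

namespace ASRModel

variable {Ω : Type*} [mΩ : MeasurableSpace Ω] {P : Measure Ω} (M : ASRModel P)

/-- The set of admissible strategies from time `n` on. -/
def admissible (n : ℕ) : Set (ASRStrategy Ω) :=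
  {s | (∀ k, n ≤ k → Measurable[M.ℱ k] (s.v k)) ∧
    IsStoppingTime M.ℱ (fun ω => (s.nstar ω : WithTop ℕ)) ∧
    ∀ ω, (s.nstar ω ∈ M.deliveryDates ∨ s.nstar ω = M.N) ∧ n ≤ s.nstar ω ∧ s.nstar ω ≤ M.N}

/-- The inventory `q_k` still to be bought, starting from `q` at time `n`. -/
def inventory (n : ℕ) (q : ℝ) (s : ASRStrategy Ω) (k : ℕ) (ω : Ω) : ℝ :=
  q - ∑ j ∈ Finset.Ico n k, s.v j ω * M.δt

/-- The price `S_k`, starting from `S` at time `n`. -/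
def price (n : ℕ) (S : ℝ) (k : ℕ) (ω : Ω) : ℝ :=
  S + M.σ * √M.δt * ∑ j ∈ Finset.Ico n k, M.ε (j + 1) ω

/-- The average price `A_k` (for `k ≥ 1`), starting from price `S` and average `A` at time `n`.
For `n = 0` it does not depend on `A`. -/
def average (n : ℕ) (A S : ℝ) (k : ℕ) (ω : Ω) : ℝ :=
  (n : ℝ) / k * A + 1 / (k : ℝ) * ∑ j ∈ Finset.Ico n k, M.price n S (j + 1) ω

/-- The cash `X_k` spent, starting from `x` (with price `S`) at time `n`. -/
def cash (n : ℕ) (x S : ℝ) (s : ASRStrategy Ω) (k : ℕ) (ω : Ω) : ℝ :=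
  x + ∑ j ∈ Finset.Ico n k, (s.v j ω * M.price n S (j + 1) ω * M.δt
    + M.L (s.v j ω / M.V (j + 1) ω) * M.V (j + 1) ω * M.δt)

/-- The normalized spread `Z_k = (S_k - A_k) / (σ √δt)`, for `k ≥ 1`. -/
def spread (n : ℕ) (A S : ℝ) (k : ℕ) (ω : Ω) : ℝ :=
  (M.price n S k ω - M.average n A S k ω) / (M.σ * √M.δt)

/-- The final wealth of the bank, starting from `(x, q, S, A)` at time `n`. -/
def wealth (n : ℕ) (x q S A : ℝ) (s : ASRStrategy Ω) (ω : Ω) : ℝ :=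
  M.Q * M.average n A S (s.nstar ω) ω - M.cash n x S s (s.nstar ω) ω
    - M.inventory n q s (s.nstar ω) ω * M.price n S (s.nstar ω) ω
    - M.ell (M.inventory n q s (s.nstar ω) ω)

/-- The expected utility `E[-exp(-γ W)]` of the final wealth, with values in `[-∞, 0]`. -/
def expectedUtility (n : ℕ) (x q S A : ℝ) (s : ASRStrategy Ω) : EReal :=
  -((∫⁻ ω, ENNReal.ofReal (Real.exp (-M.γ * M.wealth n x q S A s ω)) ∂P : ℝ≥0∞) : EReal)

/-- The cost whose exponential moment defines `θ_n(q, Z)`, for the volume curve `w`. -/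
def reducedCost (w : ℕ → ℝ) (n : ℕ) (q Z : ℝ) (s : ASRStrategy Ω) (ω : Ω) : ℝ :=
  M.σ * √M.δt *
      ((∑ j ∈ Finset.Ico n (s.nstar ω),
          (M.inventory n q s j ω - (1 - (j : ℝ) / (s.nstar ω : ℝ)) * M.Q) * M.ε (j + 1) ω)
        - (1 - (n : ℝ) / (s.nstar ω : ℝ)) * M.Q * Z)
    + ∑ j ∈ Finset.Ico n (s.nstar ω), M.L (s.v j ω / w (j + 1)) * w (j + 1) * M.δt
    + M.ell (M.inventory n q s (s.nstar ω) ω)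

/-- The function `θ_n(q, Z)`, for the volume curve `w`, with values in `[-∞, +∞]`. -/
def theta (w : ℕ → ℝ) (n : ℕ) (q Z : ℝ) : EReal :=
  ⨅ s ∈ M.admissible n, ((1 / M.γ : ℝ) : EReal) *
    ENNReal.log (∫⁻ ω, ENNReal.ofReal (Real.exp (M.γ * M.reducedCost w n q Z s ω)) ∂P)

/-- The one-step functional, as a function of the order `v`, whose infimum over `v` is
`θ̃_{n,n+1}(q, Z)`, for the volume curve `w`. -/
def stepCost (w : ℕ → ℝ) (n : ℕ) (q Z v : ℝ) : EReal :=
  ((1 / M.γ : ℝ) : EReal) * ENNReal.log (∫⁻ ω, EReal.exp ((M.γ : EReal) *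
    (((M.σ * √M.δt * ((q - M.Q / ((n : ℝ) + 1)) * M.ε (n + 1) ω - M.Q / ((n : ℝ) + 1) * Z)
        + M.L (v / w (n + 1)) * w (n + 1) * M.δt : ℝ) : EReal)
      + M.theta w (n + 1) (q - v * M.δt)
          ((n : ℝ) / ((n : ℝ) + 1) * (Z + M.ε (n + 1) ω)))) ∂P)

/-- The function `θ̃_{n,n+1}(q, Z)`, for the volume curve `w`. -/
def thetaTilde (w : ℕ → ℝ) (n : ℕ) (q Z : ℝ) : EReal :=
  ⨅ v : ℝ, M.stepCost w n q Z v

/-- The functional minimised by the order at time `0`, for the volume curve `w`. -/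
def initialCost (w : ℕ → ℝ) (v : ℝ) : EReal :=
  ((M.L (v / w 1) * w 1 * M.δt : ℝ) : EReal) + M.theta w 1 (M.Q - v * M.δt) 0

/-- In the state `ω`, the strategy `s` obeys the prescription at time `0`. -/
def ObeysAtZero (s : ASRStrategy Ω) (ω : Ω) : Prop :=
  IsMinOn (M.initialCost (fun k => M.V k ω)) Set.univ (s.v 0 ω)

/-- In the state `ω`, the strategy `s`, started from `(q, S, A)` at time `n`, obeys the prescription
at all times `k` with `n ≤ k`, `1 ≤ k < N` at which the shares have not been delivered before:
if `k` is a delivery date, it delivers at `k` if and only if `ℓ(q_k) ≤ θ̃_{k,k+1}(q_k, Z_k)`;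
and if it does not deliver at `k`, it sends an order that minimises the one-step functional
at `(q_k, Z_k)`. -/
def ObeysFrom (n : ℕ) (q S A : ℝ) (s : ASRStrategy Ω) (ω : Ω) : Prop :=
  ∀ k, n ≤ k → 1 ≤ k → k < M.N → k ≤ s.nstar ω →
    (k ∈ M.deliveryDates →
      (s.nstar ω = k ↔ (M.ell (M.inventory n q s k ω) : EReal) ≤
        M.thetaTilde (fun i => M.V i ω) k (M.inventory n q s k ω) (M.spread n A S k ω))) ∧
    (k < s.nstar ω →
      IsMinOn (M.stepCost (fun i => M.V i ω) k (M.inventory n q s k ω) (M.spread n A S k ω))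
        Set.univ (s.v k ω))

end ASRModel

end

/-! This is dynamic programming for an exponential criterion, carried out in `ℝ≥0∞`, so that no
integrability has to be checked and infinite values do no harm. Minus the final wealth is a constant
plus a cost that accumulates day by day along the Markov state (volume curve, inventory, normalized
spread) (`wealth_eq`). Since the volumes are part of the state, their randomness at time 0 needs no
separate treatment. Let `expValue` be the solution of the Bellman recursion for the expected
exponential of this cost.

Verification: consider the exponential of the accumulated cost times `expValue` at the current
state, frozen after delivery (`runningValue`). As the next innovation is independent of the past,
its expectation is nondecreasing in time for every admissible strategy, and also nonincreasing if
the strategy takes a minimising decision at each date. Comparing the two ends gives optimality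
(`lintegral_expValue_le`, `lintegral_le_expValue`).

Existence: superlinearity of `L` and Jensen's inequality make the one-step cost coercive in the
order, and Fatou's lemma makes it lower semicontinuous, so minimisers exist and the least one
depends measurably on the state (`measurable_leastArgmin`).

The prescription is stated through `theta`, defined as an infimum over strategies. Verification
along a deterministic volume curve shows that `theta` is the certainty equivalent of `expValue`
(`theta_eq`), so obeying the prescription is the same as taking minimising decisions for `expValue`.
-/

/-! ### Lower semicontinuous functions and their minimisers -/

theorem lowerSemicontinuous_mul_ennreal {X : Type*} [TopologicalSpace X] {f g : X → ℝ≥0∞}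
    (hf : LowerSemicontinuous f) (hg : LowerSemicontinuous g) :
    LowerSemicontinuous fun x => f x * g x := by
  rw [lowerSemicontinuous_iff]
  intro x
  rw [lowerSemicontinuousAt_iff]
  intro y hy
  obtain ⟨a, ha, b, hb, hab⟩ : ∃ a < f x, ∃ b < g x, y < a * b := by
    by_contra! h
    exact absurd (ENNReal.mul_le_of_forall_lt fun a ha b hb => h a ha b hb) (not_le.2 hy)
  filter_upwards [(lowerSemicontinuousAt_iff.1 (hf x)) a ha,
    (lowerSemicontinuousAt_iff.1 (hg x)) b hb] with z hza hzb
  exact hab.trans_le (mul_le_mul' hza.le hzb.le)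

/-- Fatou's lemma for integrals depending on a parameter. -/
theorem lowerSemicontinuous_lintegral {X Ω : Type*} [TopologicalSpace X]
    [FirstCountableTopology X] [MeasurableSpace Ω] (P : Measure Ω) {f : X → Ω → ℝ≥0∞}
    (hm : ∀ x, Measurable (f x)) (hf : ∀ ω, LowerSemicontinuous fun x => f x ω) :
    LowerSemicontinuous fun x => ∫⁻ ω, f x ω ∂P := by
  rw [lowerSemicontinuous_iff_le_liminf]
  intro x
  refine le_trans ?_ (lintegral_liminf_le hm)
  exact lintegral_mono fun ω => (lowerSemicontinuous_iff_le_liminf.1 (hf ω)) x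

section Argmin

variable {X : Type*} [TopologicalSpace X] {F : X → ℝ → ℝ≥0∞} {a : ℝ} {b : X → ℝ}

/-- Near `x`, orders outside a fixed compact interval cost more than the level by coercivity, and
those inside it do so by the tube lemma. The closed constraint `C` is there for the measurable
selection, which takes `C = Set.Iic t`. -/
theorem lowerSemicontinuous_iInf_of_coercive
    (hF : LowerSemicontinuous fun p : X × ℝ => F p.1 p.2) (ha : 0 < a) (hb : Continuous b)
    (hco : ∀ x v, ENNReal.ofReal (a * |v| + b x) ≤ F x v) {C : Set ℝ} (hC : IsClosed C) :
    LowerSemicontinuous fun x => ⨅ v ∈ C, F x v := by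
  rw [lowerSemicontinuous_iff]
  intro x
  rw [lowerSemicontinuousAt_iff]
  intro y hy
  obtain ⟨y', hyy', hy'⟩ := exists_between hy
  have hy't : y' ≠ ∞ := (hy'.trans_le le_top).ne
  set R := (y'.toReal + 1 - b x) / a with hR
  have hU : IsOpen {p : X × ℝ | y' < F p.1 p.2} := hF.isOpen_preimage y'
  -- Widening `R` by `1 / a` absorbs the loss of at most 1 when `b x` is replaced by `b z` for `z`
  -- near `x`.
  have hK : IsCompact (C ∩ Set.Icc (-(R + 1 / a)) (R + 1 / a)) := isCompact_Icc.inter_left hC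
  obtain ⟨u, t, hu, -, hxu, hKt, hut⟩ := generalized_tube_lemma (isCompact_singleton (x := x)) hK hU
    (by
      rintro ⟨x', v⟩ ⟨rfl, hv⟩
      exact hy'.trans_le (iInf₂_le v hv.1))
  have hbx : ∀ᶠ z in 𝓝 x, b x - 1 < b z :=
    hb.continuousAt.eventually (lt_mem_nhds (by linarith))
  filter_upwards [hu.mem_nhds (hxu rfl), hbx] with z hz hbz
  refine hyy'.trans_le (le_iInf₂ fun v hv => ?_)
  by_cases hvK : v ∈ Set.Icc (-(R + 1 / a)) (R + 1 / a)
  · exact le_of_lt (hut (Set.mk_mem_prod hz (hKt ⟨hv, hvK⟩)))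
  · refine le_trans ?_ (hco z v)
    rw [← ENNReal.ofReal_toReal hy't]
    apply ENNReal.ofReal_le_ofReal
    have h1 : R + 1 / a < |v| := by
      rw [Set.mem_Icc, ← abs_le] at hvK
      exact not_le.1 hvK
    have h2 : a * (R + 1 / a) = y'.toReal + 2 - b x := by rw [hR]; field_simp; ring
    nlinarith [mul_lt_mul_of_pos_left h1 ha]

theorem exists_isMinOn_of_coercive
    (hF : LowerSemicontinuous fun p : X × ℝ => F p.1 p.2) (ha : 0 < a)
    (hco : ∀ x v, ENNReal.ofReal (a * |v| + b x) ≤ F x v) {C : Set ℝ} (hC : IsClosed C)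
    (x : X) (hfin : ⨅ v ∈ C, F x v ≠ ∞) : ∃ v ∈ C, F x v = ⨅ v ∈ C, F x v := by
  set m := ⨅ v ∈ C, F x v with hm
  set R := (m.toReal + 1 - b x) / a with hR
  have hlsc : LowerSemicontinuous (F x) := hF.comp (by fun_prop : Continuous fun v : ℝ => (x, v))
  have hbig : ∀ v, F x v < m + 1 → v ∈ Set.Icc (-R) R := by
    intro v hv
    have h1 := (hco x v).trans_lt hv
    have h2 : m + 1 = ENNReal.ofReal (m.toReal + 1) := by
      rw [ENNReal.ofReal_add ENNReal.toReal_nonneg zero_le_one, ENNReal.ofReal_toReal hfin,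
        ENNReal.ofReal_one]
    rw [h2, ENNReal.ofReal_lt_ofReal_iff (by positivity)] at h1
    rw [Set.mem_Icc, ← abs_le, hR, le_div_iff₀ ha]
    nlinarith
  have hlt : m < m + 1 := ENNReal.lt_add_right hfin one_ne_zero
  obtain ⟨v₀, hv₀C, hv₀⟩ : ∃ v ∈ C, F x v < m + 1 := by
    by_contra! h
    exact absurd (le_iInf₂ h) (not_le.2 hlt)
  obtain ⟨v, hv, hmin⟩ := (hlsc.lowerSemicontinuousOn _).exists_isMinOn
    (s := C ∩ Set.Icc (-R) R) ⟨v₀, hv₀C, hbig v₀ hv₀⟩ (isCompact_Icc.inter_left hC)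
  refine ⟨v, hv.1, le_antisymm (le_iInf₂ fun u hu => ?_) (iInf₂_le v hv.1)⟩
  by_cases h : F x u < m + 1
  · exact hmin ⟨hu, hbig u h⟩
  · exact (hmin ⟨hv₀C, hbig v₀ hv₀⟩).trans (hv₀.le.trans (not_lt.1 h))

open Classical in
/-- The least minimiser of `F x`, and `0` if `F x` is identically infinite. -/
noncomputable def leastArgmin (F : X → ℝ → ℝ≥0∞) (x : X) : ℝ :=
  if ⨅ v, F x v = ∞ then 0 else sInf {v | F x v ≤ ⨅ u, F x u}

/-- The set of minimisers is nonempty, closed by lower semicontinuity, and bounded below by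
coercivity. -/
theorem isLeast_leastArgmin
    (hF : LowerSemicontinuous fun p : X × ℝ => F p.1 p.2) (ha : 0 < a)
    (hco : ∀ x v, ENNReal.ofReal (a * |v| + b x) ≤ F x v) (x : X) (hfin : ⨅ v, F x v ≠ ∞) :
    IsLeast {v | F x v ≤ ⨅ u, F x u} (leastArgmin F x) := by
  have hlsc : LowerSemicontinuous (F x) := hF.comp (by fun_prop : Continuous fun v : ℝ => (x, v))
  obtain ⟨v, -, hv⟩ := exists_isMinOn_of_coercive hF ha hco isClosed_univ x (by simpa using hfin)
  have hcl : IsClosed {v | F x v ≤ ⨅ u, F x u} := hlsc.isClosed_preimage _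
  have hbd : BddBelow {v | F x v ≤ ⨅ u, F x u} := by
    refine ⟨-(((⨅ u, F x u).toReal - b x) / a), fun u hu => ?_⟩
    have h1 := (hco x u).trans hu
    rw [← ENNReal.ofReal_toReal hfin, ENNReal.ofReal_le_ofReal_iff ENNReal.toReal_nonneg] at h1
    have h2 : |u| ≤ ((⨅ u, F x u).toReal - b x) / a := by
      rw [le_div_iff₀ ha]; linarith
    linarith [neg_abs_le u]
  rw [leastArgmin, if_neg hfin]
  exact hcl.isLeast_csInf ⟨v, by simpa using hv.le⟩ hbd

theorem leastArgmin_spec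
    (hF : LowerSemicontinuous fun p : X × ℝ => F p.1 p.2) (ha : 0 < a)
    (hco : ∀ x v, ENNReal.ofReal (a * |v| + b x) ≤ F x v) (x : X) :
    F x (leastArgmin F x) ≤ ⨅ u, F x u := by
  by_cases hfin : ⨅ v, F x v = ∞
  · rw [hfin]; exact le_top
  · exact (isLeast_leastArgmin hF ha hco x hfin).1

/-- Where the infimum is finite, the least minimiser is at most `t` exactly when restricting the
order to `Set.Iic t` does not raise the infimum. Both infima are lower semicontinuous in `x`, hence
measurable. -/
theorem measurable_leastArgmin [MeasurableSpace X] [BorelSpace X]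
    (hF : LowerSemicontinuous fun p : X × ℝ => F p.1 p.2) (ha : 0 < a) (hb : Continuous b)
    (hco : ∀ x v, ENNReal.ofReal (a * |v| + b x) ≤ F x v) : Measurable (leastArgmin F) := by
  have hm : Measurable fun x => ⨅ v, F x v := by
    simpa using (lowerSemicontinuous_iInf_of_coercive hF ha hb hco isClosed_univ).measurable
  have hfin : MeasurableSet {x | ⨅ v, F x v = ∞} := hm (measurableSet_singleton _)
  refine measurable_of_Iic fun t => ?_
  have ht := (lowerSemicontinuous_iInf_of_coercive hF ha hb hco (isClosed_Iic (a := t))).measurable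
  have : leastArgmin F ⁻¹' Set.Iic t = ({x | ⨅ v, F x v = ∞} ∩ {_x | (0 : ℝ) ≤ t}) ∪
      ({x | ⨅ v, F x v = ∞}ᶜ ∩ {x | ⨅ v ∈ Set.Iic t, F x v ≤ ⨅ v, F x v}) := by
    ext x
    by_cases hx : ⨅ v, F x v = ∞
    · have h0 : leastArgmin F x = 0 := if_pos hx
      simp only [Set.mem_preimage, h0, Set.mem_Iic, Set.mem_union, Set.mem_inter_iff,
        Set.mem_ofPred_eq, hx, true_and, Set.mem_compl_iff, not_true_eq_false, false_and, or_false]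
    · have hl := isLeast_leastArgmin hF ha hco x hx
      simp only [Set.mem_preimage, Set.mem_Iic, Set.mem_union, Set.mem_inter_iff, Set.mem_ofPred_eq,
        hx, false_and, false_or, Set.mem_compl_iff, not_false_eq_true, true_and]
      constructor
      · intro h
        exact (iInf₂_le (f := fun v (_ : v ∈ Set.Iic t) => F x v) _ h).trans hl.1
      · intro h
        obtain ⟨v, hv, hve⟩ := exists_isMinOn_of_coercive hF ha hco (isClosed_Iic (a := t)) x
          (ne_top_of_le_ne_top hx h)
        exact (hl.2 (hve.le.trans h)).trans hv
  rw [this]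
  exact (hfin.inter (.const _)).union (hfin.compl.inter (measurableSet_le ht hm))

end Argmin

/-! ### Integrals -/

/-- Jensen's inequality for `exp`, from its tangent line at the mean; the right-hand side may be
infinite. -/
theorem ofReal_exp_integral_le_lintegral {Ω : Type*} [MeasurableSpace Ω] {P : Measure Ω}
    [IsProbabilityMeasure P] {X : Ω → ℝ} (hX : Integrable X P) :
    ENNReal.ofReal (Real.exp (∫ ω, X ω ∂P)) ≤ ∫⁻ ω, ENNReal.ofReal (Real.exp (X ω)) ∂P := by
  set m := ∫ ω, X ω ∂P with hm
  have hlow : ∀ ω, Real.exp m * (1 + (X ω - m)) ≤ Real.exp (X ω) := by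
    intro ω
    have h1 := Real.add_one_le_exp (X ω - m)
    calc Real.exp m * (1 + (X ω - m)) ≤ Real.exp m * Real.exp (X ω - m) := by
          gcongr; linarith
      _ = Real.exp (X ω) := by rw [← Real.exp_add]; ring_nf
  by_cases hfin : ∫⁻ ω, ENNReal.ofReal (Real.exp (X ω)) ∂P = ∞
  · rw [hfin]; exact le_top
  have hint : Integrable (fun ω => Real.exp (X ω)) P := by
    refine ⟨Real.measurable_exp.comp_aemeasurable hX.aemeasurable |>.aestronglyMeasurable, ?_⟩
    rw [hasFiniteIntegral_iff_ofReal (ae_of_all _ fun ω => (Real.exp_pos _).le)]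
    exact lt_top_iff_ne_top.2 hfin
  rw [← ofReal_integral_eq_lintegral_ofReal hint (ae_of_all _ fun ω => (Real.exp_pos _).le)]
  apply ENNReal.ofReal_le_ofReal
  have hi : Integrable (fun ω => Real.exp m * (1 + (X ω - m))) P :=
    ((integrable_const _).add (hX.sub (integrable_const _))).const_mul _
  calc Real.exp m = ∫ ω, Real.exp m * (1 + (X ω - m)) ∂P := by
        have h1 : ∫ ω, (X ω - m) ∂P = 0 := by
          rw [integral_sub hX (integrable_const _)]
          simp [hm]
        have hs : Integrable (fun ω => X ω - m) P := hX.sub (integrable_const _)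
        rw [integral_const_mul, integral_add (integrable_const _) hs, h1]
        simp
    _ ≤ ∫ ω, Real.exp (X ω) ∂P := integral_mono hi hint hlow

/-- Integration against an independent variable. -/
theorem lintegral_comp_prodMk_of_indep {Ω α β : Type*} {m mΩ : MeasurableSpace Ω}
    [MeasurableSpace α] [MeasurableSpace β] {P : Measure Ω} [IsFiniteMeasure P] (hm : m ≤ mΩ)
    {Y : Ω → α} {ξ : Ω → β} (hY : Measurable[m] Y) (hξ : Measurable ξ)
    (hind : Indep (MeasurableSpace.comap ξ inferInstance) m P) {g : α × β → ℝ≥0∞}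
    (hg : Measurable g) :
    ∫⁻ ω, g (Y ω, ξ ω) ∂P = ∫⁻ ω, ∫⁻ ω', g (Y ω, ξ ω') ∂P ∂P := by
  have hY' : Measurable Y := hY.mono hm le_rfl
  have hi : IndepFun Y ξ P :=
    (indep_of_indep_of_le_right hind hY.comap_le).symm
  rw [← lintegral_map hg (hY'.prodMk hξ), hi.map_prod_eq_prod_map_map hY'.aemeasurable
    hξ.aemeasurable, lintegral_prod _ hg.aemeasurable, lintegral_map hg.lintegral_prod_right' hY']
  refine lintegral_congr fun ω => ?_
  exact lintegral_map (hg.comp measurable_prodMk_left) hξ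

noncomputable section

namespace ASRModel

/-! ### The value function, by backward recursion -/

/-- A positive volume curve. -/
abbrev VolumeCurve : Type := ↥{w : ℕ → ℝ | ∀ n, 0 < w n}

/-- A volume curve, an inventory and a normalized spread. -/
abbrev State : Type := VolumeCurve × ℝ × ℝ

variable {Ω : Type*} [mΩ : MeasurableSpace Ω] {P : Measure Ω} (M : ASRModel P)

/-- The cost of the order `v` on day `n + 1`, if the innovation is `e`. -/
def runCost (n : ℕ) (x : State) (v e : ℝ) : ℝ :=
  M.σ * √M.δt * ((x.2.1 - M.Q / ((n : ℝ) + 1)) * e - M.Q / ((n : ℝ) + 1) * x.2.2)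
    + M.L (v / x.1.1 (n + 1)) * x.1.1 (n + 1) * M.δt

/-- The state after the order `v` on day `n + 1`, if the innovation is `e`. -/
def nextState (n : ℕ) (x : State) (v e : ℝ) : State :=
  (x.1, x.2.1 - v * M.δt, (n : ℝ) / ((n : ℝ) + 1) * (x.2.2 + e))

/-- The exponential cost of the order `v` at time `n`, with terminal cost `U` at time `n + 1`. -/
def expStep (n : ℕ) (U : State → ℝ≥0∞) (x : State) (v : ℝ) : ℝ≥0∞ :=
  ∫⁻ ω, ENNReal.ofReal (Real.exp (M.γ * M.runCost n x v (M.ε (n + 1) ω))) *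
    U (M.nextState n x v (M.ε (n + 1) ω)) ∂P

/-- The exponential cost of immediate delivery. -/
def expDelivery (x : State) : ℝ≥0∞ := ENNReal.ofReal (Real.exp (M.γ * M.ell x.2.1))

/-- The exponential value function `i` days before the final date. -/
def expValueAux : ℕ → State → ℝ≥0∞
  | 0 => M.expDelivery
  | i + 1 => fun x =>
    if M.N - (i + 1) ∈ M.deliveryDates then
      min (M.expDelivery x) (⨅ v, M.expStep (M.N - (i + 1)) (expValueAux i) x v)
    else ⨅ v, M.expStep (M.N - (i + 1)) (expValueAux i) x v

/-- The exponential value function at time `n`. -/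
def expValue (n : ℕ) : State → ℝ≥0∞ := M.expValueAux (M.N - n)

/-- The exponential cost of the order `v` at time `n`, followed by optimal behaviour. -/
def expOrder (n : ℕ) (x : State) (v : ℝ) : ℝ≥0∞ := M.expStep n (M.expValue (n + 1)) x v

/-- The optimal exponential cost if delivery does not take place at time `n`. -/
def expCont (n : ℕ) (x : State) : ℝ≥0∞ := ⨅ v, M.expOrder n x v

theorem expValue_final : M.expValue M.N = M.expDelivery := by
  rw [expValue, Nat.sub_self, expValueAux]

/-- The Bellman equation in forward time; the rest is reindexing. -/
theorem expValue_of_lt {n : ℕ} (hn : n < M.N) (x : State) :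
    M.expValue n x = if n ∈ M.deliveryDates then min (M.expDelivery x) (M.expCont n x)
      else M.expCont n x := by
  obtain ⟨i, hi⟩ : ∃ i, M.N - n = i + 1 := ⟨M.N - n - 1, by omega⟩
  have h1 : M.N - (i + 1) = n := by omega
  have h2 : M.N - (n + 1) = i := by omega
  simp only [expValue, expCont, expOrder, hi, h2, expValueAux, h1]

theorem expValue_le_expDelivery {n : ℕ} (hn : n ∈ M.deliveryDates ∨ n = M.N) (x : State) :
    M.expValue n x ≤ M.expDelivery x := by
  by_cases h : n = M.N
  · rw [h, expValue_final]
  · have hmem := hn.resolve_right h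
    rw [M.expValue_of_lt (M.deliveryDates_mem n hmem).2, if_pos hmem]
    exact min_le_left _ _

theorem expValue_le_expCont {n : ℕ} (hn : n < M.N) (x : State) :
    M.expValue n x ≤ M.expCont n x := by
  rw [M.expValue_of_lt hn]
  split_ifs
  · exact min_le_right _ _
  · exact le_rfl

/-! ### Regularity of the value function -/

theorem mem_Icc_of_lt {n : ℕ} (hn : n < M.N) : n + 1 ∈ Finset.Icc 1 M.N :=
  Finset.mem_Icc.2 ⟨by omega, by omega⟩

theorem measurable_ε {n : ℕ} (hn : n < M.N) : Measurable (M.ε (n + 1)) :=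
  (M.ε_adapted n hn).mono (M.ℱ.le _) le_rfl

theorem continuous_ell : Continuous M.ell :=
  continuousOn_univ.1 (M.ell_convex.continuousOn isOpen_univ)

theorem ell_nonneg (q : ℝ) : 0 ≤ M.ell q := by
  rcases le_total 0 q with h | h
  · exact M.ell_zero ▸ M.ell_mono (Set.mem_Ici.2 le_rfl) (Set.mem_Ici.2 h) h
  · rw [← M.ell_even, ← M.ell_zero]
    exact M.ell_mono (Set.mem_Ici.2 le_rfl) (Set.mem_Ici.2 (neg_nonneg.2 h)) (neg_nonneg.2 h)

theorem continuous_expDelivery : Continuous M.expDelivery := by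
  have := M.continuous_ell
  unfold expDelivery
  exact ENNReal.continuous_ofReal.comp (by fun_prop)

theorem continuous_volume (n : ℕ) : Continuous fun x : State => x.1.1 n :=
  (continuous_apply n).comp (continuous_subtype_val.comp continuous_fst)

theorem continuous_runCost (n : ℕ) :
    Continuous fun p : (State × ℝ) × ℝ => M.runCost n p.1.1 p.1.2 p.2 := by
  have h1 : Continuous fun p : (State × ℝ) × ℝ => p.1.1.1.1 (n + 1) :=
    (continuous_volume (n + 1)).comp (by fun_prop)
  have h2 : Continuous fun p : (State × ℝ) × ℝ => p.1.2 / p.1.1.1.1 (n + 1) :=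
    (by fun_prop : Continuous fun p : (State × ℝ) × ℝ => p.1.2).div h1
      fun p => (p.1.1.1.2 (n + 1)).ne'
  have h3 := M.L_cont.comp h2
  unfold runCost
  simp only [Function.comp_def] at h3
  fun_prop

theorem continuous_nextState (n : ℕ) :
    Continuous fun p : (State × ℝ) × ℝ => M.nextState n p.1.1 p.1.2 p.2 := by
  unfold nextState
  fun_prop

theorem lowerSemicontinuous_expStep_integrand (n : ℕ) {U : State → ℝ≥0∞}
    (hU : LowerSemicontinuous U) :
    LowerSemicontinuous fun p : (State × ℝ) × ℝ =>
      ENNReal.ofReal (Real.exp (M.γ * M.runCost n p.1.1 p.1.2 p.2)) *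
        U (M.nextState n p.1.1 p.1.2 p.2) := by
  have := M.continuous_runCost n
  refine lowerSemicontinuous_mul_ennreal (Continuous.lowerSemicontinuous ?_)
    (hU.comp (M.continuous_nextState n))
  exact ENNReal.continuous_ofReal.comp (by fun_prop)

theorem lowerSemicontinuous_expStep {n : ℕ} (hn : n < M.N) {U : State → ℝ≥0∞}
    (hU : LowerSemicontinuous U) :
    LowerSemicontinuous fun p : State × ℝ => M.expStep n U p.1 p.2 := by
  obtain ⟨G, hG, h⟩ : ∃ G : (State × ℝ) × ℝ → ℝ≥0∞, (∀ p, G p =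
      ENNReal.ofReal (Real.exp (M.γ * M.runCost n p.1.1 p.1.2 p.2)) *
        U (M.nextState n p.1.1 p.1.2 p.2)) ∧ LowerSemicontinuous G :=
    ⟨_, fun _ => rfl, M.lowerSemicontinuous_expStep_integrand n hU⟩
  have heq : (fun p : State × ℝ => M.expStep n U p.1 p.2) =
      fun p => ∫⁻ ω, G (p, M.ε (n + 1) ω) ∂P := by
    funext p
    simp only [expStep, hG]
  rw [heq]
  refine lowerSemicontinuous_lintegral P (fun p => ?_) (fun ω => ?_)
  · have h2 : Measurable fun ω => ((p, M.ε (n + 1) ω) : (State × ℝ) × ℝ) :=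
      measurable_const.prodMk (M.measurable_ε hn)
    exact h.measurable.comp h2
  · have hc : Continuous fun p : State × ℝ => (p, M.ε (n + 1) ω) := by fun_prop
    exact h.comp hc

theorem exists_L_lower_bound : ∃ R : ℝ, ∀ ρ, |ρ| - R ≤ M.L ρ := by
  obtain ⟨R, hR⟩ := eventually_atTop.1 (M.L_superlinear.eventually_ge_atTop 1)
  refine ⟨max R 1, fun ρ => ?_⟩
  have habs : M.L |ρ| = M.L ρ := by
    rcases abs_choice ρ with h | h <;> rw [h]
    exact M.L_even ρ
  by_cases h : max R 1 ≤ |ρ|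
  · have h1 := hR |ρ| ((le_max_left _ _).trans h)
    have h2 : 0 < |ρ| := lt_of_lt_of_le zero_lt_one ((le_max_right _ _).trans h)
    rw [le_div_iff₀ h2, habs] at h1
    have : (1 : ℝ) ≤ max R 1 := le_max_right _ _
    linarith
  · linarith [M.L_nonneg ρ]

variable [IsProbabilityMeasure P]

/-- A lower bound for the one-step cost, from Jensen's inequality. -/
theorem exists_expStep_lower_bound {n : ℕ} (hn : n < M.N) {C : ℝ} (hC : 0 ≤ C) :
    ∃ K : ℝ, 0 ≤ K ∧ ∀ U : State → ℝ≥0∞,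
      (∀ x, ENNReal.ofReal (Real.exp (-(C * (1 + |x.2.2|)))) ≤ U x) →
      ∀ (x : State) (v : ℝ), ENNReal.ofReal (Real.exp
        (M.γ * (M.L (v / x.1.1 (n + 1)) * x.1.1 (n + 1) * M.δt) - K * (1 + |x.2.2|)))
          ≤ M.expStep n U x v := by
  have hmem := M.mem_Icc_of_lt hn
  have hint : Integrable (M.ε (n + 1)) P := (M.ε_memLp _ hmem).integrable one_le_two
  have hmean : ∫ ω, M.ε (n + 1) ω ∂P = 0 := M.ε_mean _ hmem
  set a := ∫ ω, |M.ε (n + 1) ω| ∂P with ha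
  have ha0 : 0 ≤ a := integral_nonneg fun _ => abs_nonneg _
  set s := M.γ * (M.σ * √M.δt) with hs
  have hs0 : 0 ≤ s := by have := M.γ_pos; have := M.σ_pos; positivity
  have hQ := M.Q_pos
  refine ⟨s * M.Q + C * (1 + a), by positivity, fun U hU x v => ?_⟩
  set l := M.γ * (M.L (v / x.1.1 (n + 1)) * x.1.1 (n + 1) * M.δt) with hl
  set d := M.Q / ((n : ℝ) + 1) with hd
  have hd0 : 0 ≤ d := by positivity
  have hdQ : d ≤ M.Q := div_le_self hQ.le (by linarith [(Nat.cast_nonneg n : (0 : ℝ) ≤ n)])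
  -- `Y` bounds from below the exponent of the one-step cost. Its only term containing the inventory
  -- is a multiple of the centred innovation and vanishes in the mean, which is why `K` can be
  -- uniform in the inventory.
  let Y : Ω → ℝ := fun ω => s * (x.2.1 - d) * M.ε (n + 1) ω +
    (l - s * M.Q * |x.2.2| - C * (1 + |x.2.2|) - C * |M.ε (n + 1) ω|)
  have hi1 : Integrable (fun ω => s * (x.2.1 - d) * M.ε (n + 1) ω) P := hint.const_mul _
  have hi2 : Integrable (fun ω => C * |M.ε (n + 1) ω|) P := hint.abs.const_mul _
  have hi3 : Integrable (fun ω => l - s * M.Q * |x.2.2| - C * (1 + |x.2.2|)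
      - C * |M.ε (n + 1) ω|) P := (integrable_const _).sub hi2
  have hYint : ∫ ω, Y ω ∂P = l - s * M.Q * |x.2.2| - C * (1 + |x.2.2|) - C * a := by
    simp only [Y]
    rw [integral_add hi1 hi3, integral_sub (integrable_const _) hi2, integral_const_mul,
      integral_const_mul, hmean]
    simp [ha]
  calc _ ≤ ENNReal.ofReal (Real.exp (∫ ω, Y ω ∂P)) := by
        rw [hYint]
        apply ENNReal.ofReal_le_ofReal
        apply Real.exp_le_exp.2
        have h0 := abs_nonneg x.2.2
        nlinarith [mul_nonneg hs0 hQ.le, mul_nonneg (mul_nonneg hC ha0) h0]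
    _ ≤ ∫⁻ ω, ENNReal.ofReal (Real.exp (Y ω)) ∂P :=
        ofReal_exp_integral_le_lintegral (hi1.add hi3)
    _ ≤ _ := by
        refine lintegral_mono fun ω => ?_
        refine le_trans ?_ (mul_le_mul_right (hU _) _)
        rw [← ENNReal.ofReal_mul (Real.exp_pos _).le, ← Real.exp_add]
        apply ENNReal.ofReal_le_ofReal
        apply Real.exp_le_exp.2
        set e := M.ε (n + 1) ω
        have hr : |(n : ℝ) / ((n : ℝ) + 1) * (x.2.2 + e)| ≤ |x.2.2| + |e| := by
          rw [abs_mul]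
          have h1 : |(n : ℝ) / ((n : ℝ) + 1)| ≤ 1 := by
            rw [abs_of_nonneg (by positivity), div_le_one (by positivity)]
            linarith
          calc _ ≤ 1 * |x.2.2 + e| := by gcongr
            _ ≤ _ := by rw [one_mul]; exact abs_add_le _ _
        have h2 : d * x.2.2 ≤ M.Q * |x.2.2| := by
          calc d * x.2.2 ≤ d * |x.2.2| := by gcongr; exact le_abs_self _
            _ ≤ _ := by gcongr
        have h3 : M.γ * M.runCost n x v e = s * ((x.2.1 - d) * e - d * x.2.2) + l := by
          simp only [runCost, hs, hl, hd]; ring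
        have h4 : (M.nextState n x v e).2.2 = (n : ℝ) / ((n : ℝ) + 1) * (x.2.2 + e) := rfl
        rw [h3, h4]
        simp only [Y]
        have h5 := mul_le_mul_of_nonneg_left hr hC
        have h6 := mul_le_mul_of_nonneg_left h2 hs0
        nlinarith

/-- Coercivity of the one-step cost in the order. -/
theorem exists_expStep_coercive {n : ℕ} (hn : n < M.N) {C : ℝ} (hC : 0 ≤ C) :
    ∃ a : ℝ, 0 < a ∧ ∃ b : State → ℝ, Continuous b ∧ ∀ U : State → ℝ≥0∞,
      (∀ x, ENNReal.ofReal (Real.exp (-(C * (1 + |x.2.2|)))) ≤ U x) →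
      ∀ (x : State) (v : ℝ), ENNReal.ofReal (a * |v| + b x) ≤ M.expStep n U x v := by
  obtain ⟨K, hK, h⟩ := M.exists_expStep_lower_bound hn hC
  obtain ⟨R, hR⟩ := M.exists_L_lower_bound
  have hγ := M.γ_pos
  have hδ := M.δt_pos
  refine ⟨M.γ * M.δt, by positivity,
    fun x => -(M.γ * M.δt * R * x.1.1 (n + 1)) - K * (1 + |x.2.2|), ?_, fun U hU x v => ?_⟩
  · have := continuous_volume (n + 1)
    fun_prop
  · refine le_trans (ENNReal.ofReal_le_ofReal ?_) (h U hU x v)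
    refine le_trans ?_ ((le_add_of_nonneg_right zero_le_one).trans (Real.add_one_le_exp _))
    have hw := x.1.2 (n + 1)
    -- Multiplying by the volume cancels the division inside `L`, so the slope in `|v|` is the same
    -- for all volume curves.
    have h1 : |v| - R * x.1.1 (n + 1) ≤ M.L (v / x.1.1 (n + 1)) * x.1.1 (n + 1) := by
      have h2 := mul_le_mul_of_nonneg_right (hR (v / x.1.1 (n + 1))) hw.le
      rw [abs_div, abs_of_pos hw, sub_mul, div_mul_cancel₀ _ hw.ne'] at h2
      exact h2
    have h3 := mul_le_mul_of_nonneg_left h1 (mul_pos hγ hδ).le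
    linarith

/-- The two properties must be propagated together: the lower bound makes the next step coercive,
and coercivity keeps the infimum over orders lower semicontinuous. -/
theorem expValueAux_regular (i : ℕ) (hi : i ≤ M.N) :
    LowerSemicontinuous (M.expValueAux i) ∧
      ∃ C : ℝ, 0 ≤ C ∧ ∀ x : State,
        ENNReal.ofReal (Real.exp (-(C * (1 + |x.2.2|)))) ≤ M.expValueAux i x := by
  have hdel : ∀ (K : ℝ), 0 ≤ K → ∀ x : State,
      ENNReal.ofReal (Real.exp (-(K * (1 + |x.2.2|)))) ≤ M.expDelivery x := by
    intro K hK x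
    apply ENNReal.ofReal_le_ofReal
    apply Real.exp_le_exp.2
    have h1 := mul_nonneg M.γ_pos.le (M.ell_nonneg x.2.1)
    have h2 := mul_nonneg hK (add_nonneg zero_le_one (abs_nonneg x.2.2))
    linarith
  induction i with
  | zero => exact ⟨M.continuous_expDelivery.lowerSemicontinuous, 0, le_rfl, hdel 0 le_rfl⟩
  | succ i ih =>
    obtain ⟨hlsc, C, hC, hlow⟩ := ih (by omega)
    have hn : M.N - (i + 1) < M.N := by omega
    obtain ⟨a, ha, b, hb, hco⟩ := M.exists_expStep_coercive hn hC
    obtain ⟨K, hK, hstep⟩ := M.exists_expStep_lower_bound hn hC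
    have hc : LowerSemicontinuous fun x => ⨅ v, M.expStep (M.N - (i + 1)) (M.expValueAux i) x v := by
      simpa using lowerSemicontinuous_iInf_of_coercive
        (M.lowerSemicontinuous_expStep hn hlsc) ha hb (hco _ hlow) isClosed_univ
    have hb : ∀ x : State, ENNReal.ofReal (Real.exp (-(K * (1 + |x.2.2|)))) ≤
        ⨅ v, M.expStep (M.N - (i + 1)) (M.expValueAux i) x v := by
      refine fun x => le_iInf fun v => le_trans (ENNReal.ofReal_le_ofReal (Real.exp_le_exp.2 ?_))
        (hstep _ hlow x v)
      have h1 := mul_nonneg M.γ_pos.le (mul_nonneg (mul_nonneg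
        (M.L_nonneg (v / x.1.1 (M.N - (i + 1) + 1))) (x.1.2 (M.N - (i + 1) + 1)).le) M.δt_pos.le)
      linarith
    rw [expValueAux]
    by_cases hd : M.N - (i + 1) ∈ M.deliveryDates
    · simp only [hd, if_true]
      exact ⟨M.continuous_expDelivery.lowerSemicontinuous.inf hc, K, hK,
        fun x => le_min (hdel K hK x) (hb x)⟩
    · simp only [hd, if_false]
      exact ⟨hc, K, hK, hb⟩

theorem lowerSemicontinuous_expValue (n : ℕ) : LowerSemicontinuous (M.expValue n) :=
  (M.expValueAux_regular _ (Nat.sub_le _ _)).1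

theorem lowerSemicontinuous_expOrder {n : ℕ} (hn : n < M.N) :
    LowerSemicontinuous fun p : State × ℝ => M.expOrder n p.1 p.2 :=
  M.lowerSemicontinuous_expStep hn (M.lowerSemicontinuous_expValue _)

theorem exists_expOrder_coercive {n : ℕ} (hn : n < M.N) :
    ∃ a : ℝ, 0 < a ∧ ∃ b : State → ℝ, Continuous b ∧
      ∀ (x : State) (v : ℝ), ENNReal.ofReal (a * |v| + b x) ≤ M.expOrder n x v := by
  obtain ⟨C, hC, hlow⟩ := (M.expValueAux_regular (M.N - (n + 1)) (Nat.sub_le _ _)).2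
  obtain ⟨a, ha, b, hb, hco⟩ := M.exists_expStep_coercive hn hC
  exact ⟨a, ha, b, hb, hco _ hlow⟩

theorem measurable_expCont {n : ℕ} (hn : n < M.N) : Measurable (M.expCont n) := by
  obtain ⟨a, ha, b, hb, hco⟩ := M.exists_expOrder_coercive hn
  have := lowerSemicontinuous_iInf_of_coercive
    (M.lowerSemicontinuous_expOrder hn) ha hb hco isClosed_univ
  simp only [Set.mem_univ, iInf_pos] at this
  exact this.measurable

/-- An optimal order at time `n`. -/
def optimalOrder (n : ℕ) : State → ℝ := leastArgmin (M.expOrder n)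

theorem expOrder_optimalOrder {n : ℕ} (hn : n < M.N) (x : State) :
    M.expOrder n x (M.optimalOrder n x) ≤ M.expCont n x := by
  obtain ⟨a, ha, b, hb, hco⟩ := M.exists_expOrder_coercive hn
  exact leastArgmin_spec (M.lowerSemicontinuous_expOrder hn) ha hco x

theorem measurable_optimalOrder {n : ℕ} (hn : n < M.N) : Measurable (M.optimalOrder n) := by
  obtain ⟨a, ha, b, hb, hco⟩ := M.exists_expOrder_coercive hn
  exact measurable_leastArgmin (M.lowerSemicontinuous_expOrder hn) ha hb hco

end ASRModel

namespace ASRModel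

variable {Ω : Type*} [mΩ : MeasurableSpace Ω] {P : Measure Ω} (M : ASRModel P)

/-! ### The controlled process -/

/-- The normalized spread at time `k`, starting from `z` at time `n`. -/
def spreadFrom (n : ℕ) (z : ℝ) : ℕ → Ω → ℝ
  | 0 => fun _ => z
  | k + 1 => fun ω =>
    if k < n then z else (k : ℝ) / ((k : ℝ) + 1) * (spreadFrom n z k ω + M.ε (k + 1) ω)

theorem spreadFrom_of_le {n k : ℕ} (h : k ≤ n) (z : ℝ) (ω : Ω) : M.spreadFrom n z k ω = z := by
  cases k with
  | zero => rfl
  | succ k => exact if_pos (by omega)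

theorem spreadFrom_succ {n k : ℕ} (h : n ≤ k) (z : ℝ) (ω : Ω) : M.spreadFrom n z (k + 1) ω =
    (k : ℝ) / ((k : ℝ) + 1) * (M.spreadFrom n z k ω + M.ε (k + 1) ω) :=
  if_neg (by omega)

theorem measurable_spreadFrom (n : ℕ) (z : ℝ) (k : ℕ) (hk : k ≤ M.N) :
    Measurable[M.ℱ k] (M.spreadFrom n z k) := by
  induction k with
  | zero => exact measurable_const
  | succ k ih =>
    by_cases h : k < n
    · have : M.spreadFrom n z (k + 1) = fun _ => z :=
        funext fun ω => M.spreadFrom_of_le (by omega) z ω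
      rw [this]
      exact measurable_const
    · have : M.spreadFrom n z (k + 1) = fun ω =>
          (k : ℝ) / ((k : ℝ) + 1) * (M.spreadFrom n z k ω + M.ε (k + 1) ω) :=
        funext fun ω => M.spreadFrom_succ (by omega) z ω
      rw [this]
      exact (((ih (by omega)).mono (M.ℱ.mono (Nat.le_succ k)) le_rfl).add
        (M.ε_adapted k (by omega))).const_mul _

theorem inventory_self (n : ℕ) (q : ℝ) (s : ASRStrategy Ω) (ω : Ω) :
    M.inventory n q s n ω = q := by
  simp [inventory]

theorem inventory_succ {n k : ℕ} (h : n ≤ k) (q : ℝ) (s : ASRStrategy Ω) (ω : Ω) :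
    M.inventory n q s (k + 1) ω = M.inventory n q s k ω - s.v k ω * M.δt := by
  rw [inventory, inventory, Finset.sum_Ico_succ_top h]
  ring

theorem measurable_inventory {n : ℕ} (q : ℝ) {s : ASRStrategy Ω}
    (hs : ∀ k, n ≤ k → Measurable[M.ℱ k] (s.v k)) (k : ℕ) :
    Measurable[M.ℱ k] (M.inventory n q s k) := by
  refine measurable_const.sub (Finset.measurable_fun_sum _ fun j hj => ?_)
  rw [Finset.mem_Ico] at hj
  exact ((hs j hj.1).mono (M.ℱ.mono hj.2.le) le_rfl).mul_const _

/-- The state at time `k`, starting from `(q, z)` at time `n`. -/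
def stateAt (n : ℕ) (q z : ℝ) (w : Ω → VolumeCurve) (s : ASRStrategy Ω) (k : ℕ) (ω : Ω) : State :=
  (w ω, M.inventory n q s k ω, M.spreadFrom n z k ω)

/-- The cost accumulated between the times `n` and `k`. -/
def accCost (n : ℕ) (q z : ℝ) (w : Ω → VolumeCurve) (s : ASRStrategy Ω) (k : ℕ) (ω : Ω) : ℝ :=
  ∑ j ∈ Finset.Ico n k, M.runCost j (M.stateAt n q z w s j ω) (s.v j ω) (M.ε (j + 1) ω)

/-- The total cost of the strategy `s`, with the penalty at delivery. -/
def totalCost (n : ℕ) (q z : ℝ) (w : Ω → VolumeCurve) (s : ASRStrategy Ω) (ω : Ω) : ℝ :=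
  M.accCost n q z w s (s.nstar ω) ω + M.ell (M.inventory n q s (s.nstar ω) ω)

section Dynamics

variable {n : ℕ} {q z : ℝ} {w : Ω → VolumeCurve} {s : ASRStrategy Ω}

theorem stateAt_self (ω : Ω) : M.stateAt n q z w s n ω = (w ω, q, z) := by
  rw [stateAt, inventory_self, M.spreadFrom_of_le le_rfl]

theorem stateAt_succ {k : ℕ} (h : n ≤ k) (ω : Ω) : M.stateAt n q z w s (k + 1) ω =
    M.nextState k (M.stateAt n q z w s k ω) (s.v k ω) (M.ε (k + 1) ω) := by
  simp only [stateAt, nextState, M.inventory_succ h, M.spreadFrom_succ h]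

theorem accCost_succ {k : ℕ} (h : n ≤ k) (ω : Ω) : M.accCost n q z w s (k + 1) ω =
    M.accCost n q z w s k ω +
      M.runCost k (M.stateAt n q z w s k ω) (s.v k ω) (M.ε (k + 1) ω) := by
  rw [accCost, Finset.sum_Ico_succ_top h, accCost]

theorem measurable_stateAt (hw : Measurable[M.ℱ 0] w)
    (hs : ∀ k, n ≤ k → Measurable[M.ℱ k] (s.v k)) {k : ℕ} (hk : k ≤ M.N) :
    Measurable[M.ℱ k] (M.stateAt n q z w s k) :=
  (hw.mono (M.ℱ.mono (Nat.zero_le k)) le_rfl).prodMk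
    ((M.measurable_inventory q hs k).prodMk (M.measurable_spreadFrom n z k hk))

theorem measurable_runCost_comp {α : Type*} {m : MeasurableSpace α} (k : ℕ) {x : α → State}
    {v e : α → ℝ} (hx : Measurable x) (hv : Measurable v) (he : Measurable e) :
    Measurable fun a => M.runCost k (x a) (v a) (e a) := by
  have h := (M.continuous_runCost k).measurable.comp ((hx.prodMk hv).prodMk he)
  exact h

theorem measurable_accCost (hw : Measurable[M.ℱ 0] w)
    (hs : ∀ k, n ≤ k → Measurable[M.ℱ k] (s.v k)) {k : ℕ} (hk : k ≤ M.N) :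
    Measurable[M.ℱ k] (M.accCost n q z w s k) := by
  have heq : M.accCost n q z w s k = fun ω => ∑ j ∈ Finset.Ico n k,
      M.runCost j (M.stateAt n q z w s j ω) (s.v j ω) (M.ε (j + 1) ω) := rfl
  rw [heq]
  refine Finset.measurable_fun_sum _ fun j hj => ?_
  rw [Finset.mem_Ico] at hj
  have h1 : Measurable[M.ℱ k] (M.stateAt n q z w s j) :=
    (M.measurable_stateAt hw hs (by omega)).mono (M.ℱ.mono hj.2.le) le_rfl
  have h2 : Measurable[M.ℱ k] (s.v j) := (hs j hj.1).mono (M.ℱ.mono hj.2.le) le_rfl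
  have h3 : Measurable[M.ℱ k] (M.ε (j + 1)) :=
    (M.ε_adapted j (by omega)).mono (M.ℱ.mono (by omega)) le_rfl
  exact M.measurable_runCost_comp j h1 h2 h3

theorem measurableSet_lt_nstar (hs : s ∈ M.admissible n) (k : ℕ) :
    MeasurableSet[M.ℱ k] {ω | k < s.nstar ω} := by
  have h := (hs.2.1 k).compl
  have heq : {ω | (fun ω => (s.nstar ω : WithTop ℕ)) ω ≤ k}ᶜ = {ω | k < s.nstar ω} := by
    ext ω
    simp only [Set.mem_compl_iff, Set.mem_ofPred_eq, not_le]
    exact Nat.cast_lt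
  exact (congrArg (@MeasurableSet Ω (M.ℱ k)) heq).mp h

variable [IsProbabilityMeasure P]

/-- Conditioning on the information at time `k`. -/
theorem setLIntegral_expOrder (hw : Measurable[M.ℱ 0] w) (hs : s ∈ M.admissible n) {k : ℕ}
    (hnk : n ≤ k) (hk : k < M.N) :
    ∫⁻ ω in {ω | k < s.nstar ω}, ENNReal.ofReal (Real.exp (M.γ * M.accCost n q z w s k ω)) *
      M.expOrder k (M.stateAt n q z w s k ω) (s.v k ω) ∂P =
    ∫⁻ ω in {ω | k < s.nstar ω},
      ENNReal.ofReal (Real.exp (M.γ * M.accCost n q z w s (k + 1) ω)) *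
        M.expValue (k + 1) (M.stateAt n q z w s (k + 1) ω) ∂P := by
  have hB := M.measurableSet_lt_nstar hs k
  have hB' : MeasurableSet {ω | k < s.nstar ω} := M.ℱ.le k _ hB
  obtain ⟨G, hG, hGm⟩ : ∃ G : (State × ℝ) × ℝ → ℝ≥0∞, (∀ p, G p =
      ENNReal.ofReal (Real.exp (M.γ * M.runCost k p.1.1 p.1.2 p.2)) *
        M.expValue (k + 1) (M.nextState k p.1.1 p.1.2 p.2)) ∧ Measurable G :=
    ⟨_, fun _ => rfl, (M.lowerSemicontinuous_expStep_integrand k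
      (M.lowerSemicontinuous_expValue (k + 1))).measurable⟩
  -- The event of no delivery by time `k` and the accumulated cost are both known at time `k`.
  -- Together with the state and the order they form the past variable, which is held fixed while
  -- the next innovation is integrated out.
  set e : Ω → ℝ≥0∞ := {ω | k < s.nstar ω}.indicator
    fun ω => ENNReal.ofReal (Real.exp (M.γ * M.accCost n q z w s k ω)) with he
  have hem : Measurable[M.ℱ k] e :=
    (ENNReal.measurable_ofReal.comp (Real.measurable_exp.comp
      ((M.measurable_accCost hw hs.1 hk.le).const_mul _))).indicator hB
  have he1 : ∀ ω, k < s.nstar ω →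
      e ω = ENNReal.ofReal (Real.exp (M.γ * M.accCost n q z w s k ω)) :=
    fun ω h => Set.indicator_of_mem (s := {ω | k < s.nstar ω}) h _
  have he0 : ∀ ω, ¬k < s.nstar ω → e ω = 0 :=
    fun ω h => Set.indicator_of_notMem (s := {ω | k < s.nstar ω}) h _
  clear_value e
  have hY : Measurable[M.ℱ k] fun ω => ((M.stateAt n q z w s k ω, s.v k ω), e ω) :=
    ((M.measurable_stateAt hw hs.1 hk.le).prodMk (hs.1 k hnk)).prodMk hem
  have hg : Measurable fun p : ((State × ℝ) × ℝ≥0∞) × ℝ => p.1.2 * G (p.1.1, p.2) := by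
    have : Measurable fun p : ((State × ℝ) × ℝ≥0∞) × ℝ => (p.1.1, p.2) := by fun_prop
    exact (by fun_prop : Measurable fun p : ((State × ℝ) × ℝ≥0∞) × ℝ => p.1.2).mul (hGm.comp this)
  have key := lintegral_comp_prodMk_of_indep (M.ℱ.le k) hY (M.measurable_ε hk)
    (M.ε_indep_past k hk) hg
  rw [← lintegral_indicator hB', ← lintegral_indicator hB']
  refine Eq.trans (lintegral_congr fun ω => ?_) (key.symm.trans (lintegral_congr fun ω => ?_))
  · have h1 : Measurable fun ω' =>
        G ((M.stateAt n q z w s k ω, s.v k ω), M.ε (k + 1) ω') :=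
      (hGm.comp measurable_prodMk_left).comp (M.measurable_ε hk)
    have h2 := lintegral_const_mul (μ := P) (e ω) h1
    refine Eq.trans ?_ h2.symm
    by_cases h : k < s.nstar ω
    · rw [Set.indicator_of_mem (s := {ω | k < s.nstar ω}) h, he1 ω h]
      simp only [expOrder, expStep, hG]
    · rw [Set.indicator_of_notMem (s := {ω | k < s.nstar ω}) h, he0 ω h, zero_mul]
  · by_cases h : k < s.nstar ω
    · rw [Set.indicator_of_mem (s := {ω | k < s.nstar ω}) h, he1 ω h, hG, M.accCost_succ hnk,
        M.stateAt_succ hnk, mul_add, Real.exp_add, ENNReal.ofReal_mul (Real.exp_pos _).le,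
        mul_assoc]
    · rw [Set.indicator_of_notMem (s := {ω | k < s.nstar ω}) h, he0 ω h, zero_mul]

/-! ### Verification -/

/-- The exponential of the cost accumulated until time `k`, followed by optimal behaviour. -/
def runningValue (n : ℕ) (q z : ℝ) (w : Ω → VolumeCurve) (s : ASRStrategy Ω) (k : ℕ) (ω : Ω) :
    ℝ≥0∞ :=
  if s.nstar ω < k then ENNReal.ofReal (Real.exp (M.γ * M.totalCost n q z w s ω))
  else ENNReal.ofReal (Real.exp (M.γ * M.accCost n q z w s k ω)) *
    M.expValue k (M.stateAt n q z w s k ω)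

/-- In the state `ω`, the strategy `s` obeys the prescription given by the value function. -/
def ObeysValue (n : ℕ) (q z : ℝ) (w : Ω → VolumeCurve) (s : ASRStrategy Ω) (ω : Ω) : Prop :=
  ∀ k, n ≤ k → k < M.N → k ≤ s.nstar ω →
    (k ∈ M.deliveryDates → (s.nstar ω = k ↔ M.expDelivery (M.stateAt n q z w s k ω) ≤
      M.expCont k (M.stateAt n q z w s k ω))) ∧
    (k < s.nstar ω → M.expOrder k (M.stateAt n q z w s k ω) (s.v k ω) ≤
      M.expCont k (M.stateAt n q z w s k ω))

omit [IsProbabilityMeasure P] in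
theorem exp_totalCost {k : ℕ} {ω : Ω} (h : s.nstar ω = k) :
    ENNReal.ofReal (Real.exp (M.γ * M.totalCost n q z w s ω)) =
      ENNReal.ofReal (Real.exp (M.γ * M.accCost n q z w s k ω)) *
        M.expDelivery (M.stateAt n q z w s k ω) := by
  rw [totalCost, h, mul_add, Real.exp_add, ENNReal.ofReal_mul (Real.exp_pos _).le]
  rfl

/-- Before delivery, the value is at most the cost of the order actually sent, which is the
conditional expectation one day later. At delivery, the value is at most the delivery cost;
afterwards nothing changes. -/
theorem lintegral_runningValue_le_succ (hw : Measurable[M.ℱ 0] w) (hs : s ∈ M.admissible n)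
    {k : ℕ} (hnk : n ≤ k) (hk : k < M.N) :
    ∫⁻ ω, M.runningValue n q z w s k ω ∂P ≤ ∫⁻ ω, M.runningValue n q z w s (k + 1) ω ∂P := by
  have hB : MeasurableSet {ω | k < s.nstar ω} := M.ℱ.le k _ (M.measurableSet_lt_nstar hs k)
  rw [← lintegral_add_compl _ hB, ← lintegral_add_compl (M.runningValue n q z w s (k + 1)) hB]
  refine add_le_add ?_ (setLIntegral_mono' hB.compl fun ω hω => ?_)
  · calc _ ≤ _ := setLIntegral_mono' hB fun ω hω => ?_
      _ = _ := M.setLIntegral_expOrder (q := q) (z := z) hw hs hnk hk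
      _ = _ := setLIntegral_congr_fun hB fun ω hω => ?_
    · rw [Set.mem_ofPred_eq] at hω
      rw [runningValue, if_neg (by omega)]
      exact mul_le_mul_right ((M.expValue_le_expCont hk _).trans (iInf_le _ _)) _
    · rw [Set.mem_ofPred_eq] at hω
      simp only [runningValue]
      rw [if_neg (by omega)]
  · rw [Set.mem_compl_iff, Set.mem_ofPred_eq, not_lt] at hω
    rw [runningValue, runningValue, if_pos (by omega : s.nstar ω < k + 1)]
    rcases hω.lt_or_eq with h | h
    · rw [if_pos h]
    · rw [if_neg (by omega), M.exp_totalCost h]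
      have := (hs.2.2 ω).1
      rw [h] at this
      exact mul_le_mul_right (M.expValue_le_expDelivery this _) _

/-- For a strategy with minimising decisions the inequalities of `lintegral_runningValue_le_succ`
are reversed: delivery means that the delivery cost attains the minimum in the Bellman equation, and
refusal at a delivery date means that continuing does. -/
theorem lintegral_runningValue_succ_le (hw : Measurable[M.ℱ 0] w) (hs : s ∈ M.admissible n)
    (ho : ∀ᵐ ω ∂P, M.ObeysValue n q z w s ω) {k : ℕ} (hnk : n ≤ k) (hk : k < M.N) :
    ∫⁻ ω, M.runningValue n q z w s (k + 1) ω ∂P ≤ ∫⁻ ω, M.runningValue n q z w s k ω ∂P := by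
  have hB : MeasurableSet {ω | k < s.nstar ω} := M.ℱ.le k _ (M.measurableSet_lt_nstar hs k)
  rw [← lintegral_add_compl _ hB, ← lintegral_add_compl (M.runningValue n q z w s k) hB]
  refine add_le_add ?_ (lintegral_mono_ae ?_)
  · calc _ = _ := setLIntegral_congr_fun hB fun ω hω => ?_
      _ = _ := (M.setLIntegral_expOrder (q := q) (z := z) hw hs hnk hk).symm
      _ ≤ _ := lintegral_mono_ae ?_
    · rw [Set.mem_ofPred_eq] at hω
      simp only [runningValue]
      rw [if_neg (by omega)]
    · filter_upwards [ae_restrict_of_ae ho, ae_restrict_mem hB] with ω hω hlt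
      replace hlt : k < s.nstar ω := hlt
      obtain ⟨h1, h2⟩ := hω k hnk hk hlt.le
      rw [runningValue, if_neg (by omega), M.expValue_of_lt hk]
      refine mul_le_mul_right ((h2 hlt).trans ?_) _
      split_ifs with hd
      · have h3 := mt (h1 hd).2 hlt.ne'
        exact le_min (not_le.1 h3).le le_rfl
      · exact le_rfl
  · filter_upwards [ae_restrict_of_ae ho, ae_restrict_mem hB.compl] with ω hω hle
    rw [Set.mem_compl_iff, Set.mem_ofPred_eq, not_lt] at hle
    rw [runningValue, runningValue, if_pos (by omega : s.nstar ω < k + 1)]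
    rcases hle.lt_or_eq with h | h
    · rw [if_pos h]
    · rw [if_neg (by omega), M.exp_totalCost h, M.expValue_of_lt hk]
      have hd := (hs.2.2 ω).1
      rw [h] at hd
      have hd' := hd.resolve_right hk.ne
      rw [if_pos hd', min_eq_left (((hω k hnk hk h.ge).1 hd').1 h)]

omit [IsProbabilityMeasure P] in
theorem runningValue_self (hs : s ∈ M.admissible n) (ω : Ω) :
    M.runningValue n q z w s n ω = M.expValue n (w ω, q, z) := by
  have := (hs.2.2 ω).2.1
  rw [runningValue, if_neg (by omega), stateAt_self]
  simp [accCost]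

omit [IsProbabilityMeasure P] in
theorem runningValue_final (hs : s ∈ M.admissible n) (ω : Ω) :
    M.runningValue n q z w s M.N ω = ENNReal.ofReal (Real.exp (M.γ * M.totalCost n q z w s ω)) := by
  rw [runningValue]
  split_ifs with h
  · rfl
  · have := (hs.2.2 ω).2.2
    rw [M.exp_totalCost (le_antisymm this (not_lt.1 h)), expValue_final]

theorem lintegral_expValue_le (hn : n ≤ M.N) (hw : Measurable[M.ℱ 0] w)
    (hs : s ∈ M.admissible n) : ∫⁻ ω, M.expValue n (w ω, q, z) ∂P ≤
      ∫⁻ ω, ENNReal.ofReal (Real.exp (M.γ * M.totalCost n q z w s ω)) ∂P := by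
  have h : ∀ k, n ≤ k → k ≤ M.N →
      ∫⁻ ω, M.runningValue n q z w s n ω ∂P ≤ ∫⁻ ω, M.runningValue n q z w s k ω ∂P := by
    intro k hnk
    induction k, hnk using Nat.le_induction with
    | base => exact fun _ => le_rfl
    | succ k hnk ih =>
      exact fun hk => (ih (by omega)).trans (M.lintegral_runningValue_le_succ hw hs hnk hk)
  simpa only [M.runningValue_self hs, M.runningValue_final hs] using h M.N hn le_rfl

theorem lintegral_le_expValue (hn : n ≤ M.N) (hw : Measurable[M.ℱ 0] w)
    (hs : s ∈ M.admissible n) (ho : ∀ᵐ ω ∂P, M.ObeysValue n q z w s ω) :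
    ∫⁻ ω, ENNReal.ofReal (Real.exp (M.γ * M.totalCost n q z w s ω)) ∂P ≤
      ∫⁻ ω, M.expValue n (w ω, q, z) ∂P := by
  have h : ∀ k, n ≤ k → k ≤ M.N →
      ∫⁻ ω, M.runningValue n q z w s k ω ∂P ≤ ∫⁻ ω, M.runningValue n q z w s n ω ∂P := by
    intro k hnk
    induction k, hnk using Nat.le_induction with
    | base => exact fun _ => le_rfl
    | succ k hnk ih =>
      exact fun hk => (M.lintegral_runningValue_succ_le hw hs ho hnk hk).trans (ih (by omega))
  simpa only [M.runningValue_self hs, M.runningValue_final hs] using h M.N hn le_rfl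

end Dynamics

/-! ### Existence of an optimal strategy -/

section Existence

variable (n : ℕ) (q z : ℝ) (w : Ω → VolumeCurve)

/-- The inventory at time `k` under the optimal orders, starting from `(q, z)` at time `n`. -/
def optimalInventory : ℕ → Ω → ℝ
  | 0 => fun _ => q
  | k + 1 => fun ω => if k < n then q else optimalInventory k ω -
      M.optimalOrder k (w ω, optimalInventory k ω, M.spreadFrom n z k ω) * M.δt

/-- The state at time `k` under the optimal orders. -/
def optimalState (k : ℕ) (ω : Ω) : State :=
  (w ω, M.optimalInventory n q z w k ω, M.spreadFrom n z k ω)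

open Classical in
/-- The strategy that follows the optimal orders, and delivers when this is optimal. -/
def optimalStrategy : ASRStrategy Ω where
  -- The value 0 from the final date on only secures adaptedness, which admissibility requires at
  -- all later times.
  v k ω := if k < M.N then M.optimalOrder k (M.optimalState n q z w k ω) else 0
  nstar ω := sInf {k | n ≤ k ∧ (k = M.N ∨ (k ∈ M.deliveryDates ∧
    M.expDelivery (M.optimalState n q z w k ω) ≤ M.expCont k (M.optimalState n q z w k ω)))}

variable {n q z w}

theorem optimalInventory_of_le {k : ℕ} (h : k ≤ n) (ω : Ω) :
    M.optimalInventory n q z w k ω = q := by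
  cases k with
  | zero => rfl
  | succ k => exact if_pos (by omega)

theorem optimalInventory_succ {k : ℕ} (h : n ≤ k) (ω : Ω) :
    M.optimalInventory n q z w (k + 1) ω = M.optimalInventory n q z w k ω -
      M.optimalOrder k (M.optimalState n q z w k ω) * M.δt :=
  if_neg (by omega)

theorem optimalStrategy_v {k : ℕ} (hk : k < M.N) (ω : Ω) :
    (M.optimalStrategy n q z w).v k ω = M.optimalOrder k (M.optimalState n q z w k ω) :=
  if_pos hk

/-- The optimal orders depend on the inventory that they generate; `optimalInventory` breaks this
circle by a recursion of its own, which is here matched with the inventory of the resulting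
strategy. -/
theorem inventory_optimalStrategy {k : ℕ} (hnk : n ≤ k) (hk : k ≤ M.N) (ω : Ω) :
    M.inventory n q (M.optimalStrategy n q z w) k ω = M.optimalInventory n q z w k ω := by
  induction k, hnk using Nat.le_induction with
  | base => rw [inventory_self, M.optimalInventory_of_le le_rfl]
  | succ k hnk ih =>
    rw [M.inventory_succ hnk, M.optimalInventory_succ hnk, ih (by omega),
      M.optimalStrategy_v (by omega)]

theorem stateAt_optimalStrategy {k : ℕ} (hnk : n ≤ k) (hk : k ≤ M.N) (ω : Ω) :
    M.stateAt n q z w (M.optimalStrategy n q z w) k ω = M.optimalState n q z w k ω := by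
  rw [stateAt, M.inventory_optimalStrategy hnk hk, optimalState]

variable [IsProbabilityMeasure P]

theorem measurable_optimalState (hw : Measurable[M.ℱ 0] w) {k : ℕ} (hk : k ≤ M.N) :
    Measurable[M.ℱ k] (M.optimalState n q z w k) := by
  have h : Measurable[M.ℱ k] (M.optimalInventory n q z w k) := by
    induction k with
    | zero => exact measurable_const
    | succ k ih =>
      by_cases h : k < n
      · have : M.optimalInventory n q z w (k + 1) = fun _ => q :=
          funext fun ω => M.optimalInventory_of_le (by omega) ω
        rw [this]
        exact measurable_const
      · have : M.optimalInventory n q z w (k + 1) = fun ω => M.optimalInventory n q z w k ω -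
            M.optimalOrder k (M.optimalState n q z w k ω) * M.δt :=
          funext fun ω => M.optimalInventory_succ (by omega) ω
        rw [this]
        have hle := M.ℱ.mono (Nat.le_succ k)
        have h1 := ih (by omega)
        have h2 : Measurable[M.ℱ k] (M.optimalState n q z w k) :=
          (hw.mono (M.ℱ.mono (Nat.zero_le k)) le_rfl).prodMk
            (h1.prodMk (M.measurable_spreadFrom n z k (by omega)))
        have h3 : Measurable[M.ℱ k] fun ω => M.optimalOrder k (M.optimalState n q z w k ω) :=
          (M.measurable_optimalOrder (by omega)).comp h2
        exact (h1.mono hle le_rfl).sub ((h3.mono hle le_rfl).mul_const _)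
  exact (hw.mono (M.ℱ.mono (Nat.zero_le k)) le_rfl).prodMk
    (h.prodMk (M.measurable_spreadFrom n z k hk))

omit [IsProbabilityMeasure P] in
theorem nstar_optimalStrategy_mem (hn : n ≤ M.N) (ω : Ω) :
    n ≤ (M.optimalStrategy n q z w).nstar ω ∧ ((M.optimalStrategy n q z w).nstar ω = M.N ∨
      ((M.optimalStrategy n q z w).nstar ω ∈ M.deliveryDates ∧
        M.expDelivery (M.optimalState n q z w ((M.optimalStrategy n q z w).nstar ω) ω) ≤
          M.expCont ((M.optimalStrategy n q z w).nstar ω)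
            (M.optimalState n q z w ((M.optimalStrategy n q z w).nstar ω) ω))) :=
  Nat.sInf_mem (s := {k | n ≤ k ∧ (k = M.N ∨ (k ∈ M.deliveryDates ∧
    M.expDelivery (M.optimalState n q z w k ω) ≤ M.expCont k (M.optimalState n q z w k ω)))})
    ⟨M.N, hn, Or.inl rfl⟩

omit [IsProbabilityMeasure P] in
theorem nstar_optimalStrategy_le {k : ℕ} {ω : Ω} (hnk : n ≤ k) (h : k = M.N ∨
    (k ∈ M.deliveryDates ∧ M.expDelivery (M.optimalState n q z w k ω) ≤
      M.expCont k (M.optimalState n q z w k ω))) :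
    (M.optimalStrategy n q z w).nstar ω ≤ k :=
  Nat.sInf_le ⟨hnk, h⟩

theorem optimalStrategy_mem_admissible (hn : n ≤ M.N) (hw : Measurable[M.ℱ 0] w) :
    M.optimalStrategy n q z w ∈ M.admissible n := by
  refine ⟨fun k _ => ?_, fun i => ?_, fun ω => ?_⟩
  · by_cases hk : k < M.N
    · simp only [optimalStrategy, hk, if_true]
      exact (M.measurable_optimalOrder hk).comp (M.measurable_optimalState hw hk.le)
    · simp only [optimalStrategy, hk, if_false]
      exact measurable_const
  · have heq : {ω | (fun ω => ((M.optimalStrategy n q z w).nstar ω : WithTop ℕ)) ω ≤ i} =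
        ⋃ k ∈ {k | k ≤ i ∧ n ≤ k}, {ω | k = M.N ∨ (k ∈ M.deliveryDates ∧
          M.expDelivery (M.optimalState n q z w k ω) ≤
            M.expCont k (M.optimalState n q z w k ω))} := by
      ext ω
      simp only [Set.mem_ofPred_eq, Set.mem_iUnion, exists_prop]
      refine (Nat.cast_le (α := WithTop ℕ)).trans ⟨fun h => ?_, ?_⟩
      · have := M.nstar_optimalStrategy_mem (q := q) (z := z) (w := w) hn ω
        exact ⟨_, ⟨h, this.1⟩, this.2⟩
      · rintro ⟨k, ⟨hki, hnk⟩, hk⟩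
        exact (M.nstar_optimalStrategy_le hnk hk).trans hki
    refine heq ▸ MeasurableSet.biUnion (Set.to_countable _) fun k hk => ?_
    rw [Set.mem_ofPred_eq] at hk
    refine (MeasurableSet.const (k = M.N)).union ?_
    -- Membership gives `k < M.N`, the range in which `expCont k` is known to be measurable.
    by_cases hd : k ∈ M.deliveryDates
    · have hkN := (M.deliveryDates_mem k hd).2
      have hst : Measurable[M.ℱ i] (M.optimalState n q z w k) :=
        (M.measurable_optimalState hw hkN.le).mono (M.ℱ.mono hk.1) le_rfl
      exact (MeasurableSet.const (k ∈ M.deliveryDates)).inter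
        (measurableSet_le (M.continuous_expDelivery.measurable.comp hst)
          ((M.measurable_expCont hkN).comp hst))
    · exact (congrArg (@MeasurableSet Ω (M.ℱ i)) (Set.eq_empty_of_forall_notMem
        fun ω (h : k ∈ M.deliveryDates ∧ M.expDelivery (M.optimalState n q z w k ω) ≤
          M.expCont k (M.optimalState n q z w k ω)) => hd h.1)).mpr (@MeasurableSet.empty Ω (M.ℱ i))
  · have h := M.nstar_optimalStrategy_mem (q := q) (z := z) (w := w) hn ω
    exact ⟨h.2.symm.imp_left And.left, h.1, M.nstar_optimalStrategy_le hn (Or.inl rfl)⟩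

theorem optimalStrategy_obeysValue (hn : n ≤ M.N) (ω : Ω) :
    M.ObeysValue n q z w (M.optimalStrategy n q z w) ω := by
  intro k hnk hk hle
  rw [M.stateAt_optimalStrategy hnk hk.le]
  refine ⟨fun hd => ⟨fun h => ?_, fun h => ?_⟩, fun _ => ?_⟩
  · have := (M.nstar_optimalStrategy_mem (q := q) (z := z) (w := w) hn ω).2
    rw [h] at this
    exact (this.resolve_left hk.ne).2
  · exact le_antisymm (M.nstar_optimalStrategy_le hnk (Or.inr ⟨hd, h⟩)) hle
  · rw [M.optimalStrategy_v hk]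
    exact M.expOrder_optimalOrder hk _

end Existence

end ASRModel

namespace ASRModel

variable {Ω : Type*} [mΩ : MeasurableSpace Ω] {P : Measure Ω} (M : ASRModel P)

/-! ### Wealth and reduced cost -/

theorem scale_pos : 0 < M.σ * √M.δt := mul_pos M.σ_pos (Real.sqrt_pos.2 M.δt_pos)

theorem price_self (n : ℕ) (S : ℝ) (ω : Ω) : M.price n S n ω = S := by
  simp [price]

theorem price_succ {n k : ℕ} (h : n ≤ k) (S : ℝ) (ω : Ω) :
    M.price n S (k + 1) ω = M.price n S k ω + M.σ * √M.δt * M.ε (k + 1) ω := by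
  rw [price, price, Finset.sum_Ico_succ_top h]
  ring

theorem average_succ {n k : ℕ} (h : n ≤ k) (A S : ℝ) (ω : Ω) :
    ((k : ℝ) + 1) * M.average n A S (k + 1) ω =
      k * M.average n A S k ω + M.price n S (k + 1) ω := by
  have hk1 : (k : ℝ) + 1 ≠ 0 := by positivity
  rw [average, average, Finset.sum_Ico_succ_top h]
  push_cast
  -- At `k = 0` the average involves a division by zero, but it enters with the factor `k = 0`.
  rcases Nat.eq_zero_or_pos k with h0 | h0
  · subst h0
    obtain rfl : n = 0 := by omega
    simp
  · have hk : (k : ℝ) ≠ 0 := by positivity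
    field_simp
    ring

theorem spread_succ {n k : ℕ} (h : n ≤ k) (A S : ℝ) (ω : Ω) : M.spread n A S (k + 1) ω =
    (k : ℝ) / ((k : ℝ) + 1) * (M.spread n A S k ω + M.ε (k + 1) ω) := by
  have hs := M.scale_pos.ne'
  have hk1 : (k : ℝ) + 1 ≠ 0 := by positivity
  have h1 := M.average_succ h A S ω
  rw [M.price_succ h] at h1
  rw [spread, spread, M.price_succ h]
  generalize M.σ * √M.δt = c at *
  field_simp
  linear_combination -h1

theorem spread_eq_spreadFrom {n k : ℕ} (h : n ≤ k) (A S : ℝ) (ω : Ω) :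
    M.spread n A S k ω = M.spreadFrom n (M.spread n A S n ω) k ω := by
  induction k, h using Nat.le_induction with
  | base => rw [M.spreadFrom_of_le le_rfl]
  | succ k h ih => rw [M.spread_succ h, M.spreadFrom_succ h, ih]

/-- The normalized spread at the starting time. -/
def spreadAt (n : ℕ) (A S : ℝ) : ℝ :=
  -- The quotient `n / n` is 1 for positive `n` and 0 at `n = 0`, where `A` must drop out.
  (S - (n : ℝ) / n * A) / (M.σ * √M.δt)

theorem spread_self (n : ℕ) (A S : ℝ) (ω : Ω) : M.spread n A S n ω = M.spreadAt n A S := by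
  simp [spread, spreadAt, price_self, average]

/-- The curve of market volumes. -/
def volumeCurve (ω : Ω) : VolumeCurve := ⟨fun k => M.V k ω, fun k => M.V_pos k ω⟩

theorem measurable_volumeCurve : Measurable[M.ℱ 0] M.volumeCurve := by
  have h : Measurable[M.ℱ 0] fun ω k => M.V k ω :=
    @measurable_pi_lambda _ _ _ (M.ℱ 0) _ _ fun k => M.V_measurable k
  exact Measurable.subtype_mk h

/-- Summation by parts: over one day, cash plus inventory at market price minus `Q` times the
average changes by exactly `runCost`, since the payment for the order cancels against the change of
inventory at the new price. -/
theorem wealth_eq (n : ℕ) (x q S A : ℝ) {s : ASRStrategy Ω} (hs : s ∈ M.admissible n) (ω : Ω) :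
    -M.wealth n x q S A s ω = x + q * S - M.Q * ((n : ℝ) / n * A) +
      M.totalCost n q (M.spreadAt n A S) M.volumeCurve s ω := by
  have key : ∀ k, n ≤ k → M.cash n x S s k ω + M.inventory n q s k ω * M.price n S k ω -
      M.Q * M.average n A S k ω = x + q * S - M.Q * ((n : ℝ) / n * A) +
        M.accCost n q (M.spreadAt n A S) M.volumeCurve s k ω := by
    intro k h
    induction k, h using Nat.le_induction with
    | base => simp [cash, inventory, price, average, accCost]
    | succ k h ih =>
      have hk1 : (k : ℝ) + 1 ≠ 0 := by positivity
      have h1 := M.average_succ h A S ω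
      have h2 : M.cash n x S s (k + 1) ω = M.cash n x S s k ω +
          (s.v k ω * M.price n S (k + 1) ω * M.δt +
            M.L (s.v k ω / M.V (k + 1) ω) * M.V (k + 1) ω * M.δt) := by
        rw [cash, cash, Finset.sum_Ico_succ_top h]
        ring
      have h3 : M.σ * √M.δt * M.spreadFrom n (M.spreadAt n A S) k ω =
          M.price n S k ω - M.average n A S k ω := by
        rw [← M.spread_self n A S ω, ← M.spread_eq_spreadFrom h, spread,
          mul_div_cancel₀ _ M.scale_pos.ne']
      rw [M.accCost_succ h, ← add_assoc, ← ih, h2, M.inventory_succ h]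
      simp only [runCost, stateAt, volumeCurve]
      have h4 : M.average n A S (k + 1) ω =
          (k * M.average n A S k ω + M.price n S (k + 1) ω) / ((k : ℝ) + 1) := by
        rw [← h1, mul_div_cancel_left₀ _ hk1]
      have h5 : M.σ * √M.δt * ((M.inventory n q s k ω - M.Q / ((k : ℝ) + 1)) * M.ε (k + 1) ω
          - M.Q / ((k : ℝ) + 1) * M.spreadFrom n (M.spreadAt n A S) k ω) =
          (M.inventory n q s k ω - M.Q / ((k : ℝ) + 1)) * (M.σ * √M.δt * M.ε (k + 1) ω)
          - M.Q / ((k : ℝ) + 1) * (M.price n S k ω - M.average n A S k ω) := by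
        rw [← h3]; ring
      rw [h5, h4, M.price_succ h]
      field_simp
      ring
  have h := key _ (hs.2.2 ω).2.1
  rw [wealth, totalCost, ← add_assoc, ← h]
  ring

/-- In units of `σ √δt`, the summand is the daily increment of the average price, so the first
identity writes the total change of the average in terms of the innovations. Its induction step uses
the second identity, hence the joint statement. -/
theorem sum_spreadFrom {n m : ℕ} (h : n ≤ m) (z : ℝ) (ω : Ω) :
    (m : ℝ) * ∑ j ∈ Finset.Ico n m, (M.spreadFrom n z j ω + M.ε (j + 1) ω) / ((j : ℝ) + 1) =
      ∑ j ∈ Finset.Ico n m, ((m : ℝ) - j) * M.ε (j + 1) ω + ((m : ℝ) - n) * z ∧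
    M.spreadFrom n z m ω = z + ∑ j ∈ Finset.Ico n m, M.ε (j + 1) ω -
      ∑ j ∈ Finset.Ico n m, (M.spreadFrom n z j ω + M.ε (j + 1) ω) / ((j : ℝ) + 1) := by
  induction m, h using Nat.le_induction with
  | base => simp [M.spreadFrom_of_le le_rfl]
  | succ m h ih =>
    obtain ⟨ih1, ih2⟩ := ih
    have hm : (m : ℝ) + 1 ≠ 0 := by positivity
    have h1 : ∑ j ∈ Finset.Ico n m, (((m + 1 : ℕ) : ℝ) - j) * M.ε (j + 1) ω =
        ∑ j ∈ Finset.Ico n m, ((m : ℝ) - j) * M.ε (j + 1) ω +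
          ∑ j ∈ Finset.Ico n m, M.ε (j + 1) ω := by
      rw [← Finset.sum_add_distrib]
      refine Finset.sum_congr rfl fun j _ => ?_
      push_cast
      ring
    rw [Finset.sum_Ico_succ_top h, Finset.sum_Ico_succ_top h, Finset.sum_Ico_succ_top h, h1,
      M.spreadFrom_succ h]
    push_cast
    constructor
    · rw [mul_add, mul_div_cancel₀ _ hm]
      linear_combination ih1 + ih2
    · field_simp
      linear_combination ((m : ℝ) + 1) * ih2

/-- The cost defining `theta` weights innovations by a delivery date not yet known when they occur,
whereas `totalCost` accumulates day by day. They agree path by path once the spread terms are summed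
up to the delivery date. -/
theorem reducedCost_eq {n : ℕ} (hn : 1 ≤ n) (q z : ℝ) (w : VolumeCurve) {s : ASRStrategy Ω}
    (hs : s ∈ M.admissible n) (ω : Ω) :
    M.reducedCost w.1 n q z s ω = M.totalCost n q z (fun _ => w) s ω := by
  have hm := (hs.2.2 ω).2.1
  rw [reducedCost, totalCost]
  generalize s.nstar ω = m at *
  have hm0 : (m : ℝ) ≠ 0 := by
    have : 0 < m := by omega
    positivity
  have h1 := (M.sum_spreadFrom hm z ω).1
  have h2 : M.accCost n q z (fun _ => w) s m ω =
      M.σ * √M.δt * (∑ j ∈ Finset.Ico n m, M.inventory n q s j ω * M.ε (j + 1) ω -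
        M.Q * ∑ j ∈ Finset.Ico n m, (M.spreadFrom n z j ω + M.ε (j + 1) ω) / ((j : ℝ) + 1)) +
      ∑ j ∈ Finset.Ico n m, M.L (s.v j ω / w.1 (j + 1)) * w.1 (j + 1) * M.δt := by
    rw [accCost, Finset.mul_sum, ← Finset.sum_sub_distrib, Finset.mul_sum,
      ← Finset.sum_add_distrib]
    refine Finset.sum_congr rfl fun j _ => ?_
    simp only [runCost, stateAt]
    ring
  have h3 : ∑ j ∈ Finset.Ico n m, (M.inventory n q s j ω - (1 - (j : ℝ) / m) * M.Q) *
      M.ε (j + 1) ω = ∑ j ∈ Finset.Ico n m, M.inventory n q s j ω * M.ε (j + 1) ω -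
        M.Q / m * ∑ j ∈ Finset.Ico n m, ((m : ℝ) - j) * M.ε (j + 1) ω := by
    rw [Finset.mul_sum, ← Finset.sum_sub_distrib]
    refine Finset.sum_congr rfl fun j _ => ?_
    field_simp
  rw [h2, h3]
  have h4 : M.Q * ∑ j ∈ Finset.Ico n m, (M.spreadFrom n z j ω + M.ε (j + 1) ω) / ((j : ℝ) + 1) =
      M.Q / m * (∑ j ∈ Finset.Ico n m, ((m : ℝ) - j) * M.ε (j + 1) ω + ((m : ℝ) - n) * z) := by
    rw [← h1]
    field_simp
  rw [h4]
  have h5 : (1 - (n : ℝ) / m) * M.Q * z = M.Q / m * (((m : ℝ) - n) * z) := by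
    field_simp
  rw [h5]
  ring

/-! ### The certainty equivalent -/

/-- The certainty equivalent of an exponential cost. -/
def certEquiv (u : ℝ≥0∞) : EReal := ((1 / M.γ : ℝ) : EReal) * ENNReal.log u

theorem exp_mul_certEquiv (u : ℝ≥0∞) : EReal.exp ((M.γ : EReal) * M.certEquiv u) = u := by
  have h : (M.γ : EReal) * M.certEquiv u = ENNReal.log u := by
    rw [certEquiv, ← mul_assoc, ← EReal.coe_mul, mul_one_div_cancel M.γ_pos.ne', EReal.coe_one,
      one_mul]
  rw [h, ENNReal.exp_log]

theorem certEquiv_le_iff {u v : ℝ≥0∞} : M.certEquiv u ≤ M.certEquiv v ↔ u ≤ v := by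
  have hγ : (0 : EReal) ≤ (M.γ : EReal) := EReal.coe_nonneg.2 M.γ_pos.le
  have hγ' : (0 : EReal) ≤ ((1 / M.γ : ℝ) : EReal) :=
    EReal.coe_nonneg.2 (one_div_pos.2 M.γ_pos).le
  refine ⟨fun h => ?_, fun h => mul_le_mul_of_nonneg_left (ENNReal.log_monotone h) hγ'⟩
  rw [← M.exp_mul_certEquiv u, ← M.exp_mul_certEquiv v]
  exact EReal.exp_monotone (mul_le_mul_of_nonneg_left h hγ)

theorem exp_mul_add_certEquiv (a : ℝ) (u : ℝ≥0∞) :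
    EReal.exp ((M.γ : EReal) * ((a : EReal) + M.certEquiv u)) =
      ENNReal.ofReal (Real.exp (M.γ * a)) * u := by
  rw [EReal.left_distrib_of_nonneg_of_ne_top (EReal.coe_nonneg.2 M.γ_pos.le)
    (EReal.coe_ne_top _), EReal.exp_add, exp_mul_certEquiv, ← EReal.coe_mul, EReal.exp_coe]

theorem certEquiv_eq_iff {u : ℝ≥0∞} {y : EReal} :
    y = M.certEquiv u ↔ EReal.exp ((M.γ : EReal) * y) = u := by
  refine ⟨fun h => h ▸ M.exp_mul_certEquiv u, fun h => ?_⟩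
  rw [certEquiv, ← h, EReal.log_exp, ← mul_assoc, ← EReal.coe_mul,
    one_div_mul_cancel M.γ_pos.ne', EReal.coe_one, one_mul]

theorem ell_eq_certEquiv (x : State) : (M.ell x.2.1 : EReal) = M.certEquiv (M.expDelivery x) := by
  rw [certEquiv_eq_iff, ← EReal.coe_mul, EReal.exp_coe, expDelivery]

variable [IsProbabilityMeasure P]

/-- Verification is applied to a constant volume curve: every strategy costs at least `expValue`,
and `optimalStrategy` attains it. -/
theorem theta_eq {n : ℕ} (hn : 1 ≤ n) (hnN : n ≤ M.N) (w : VolumeCurve) (q z : ℝ) :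
    M.theta w.1 n q z = M.certEquiv (M.expValue n (w, q, z)) := by
  have hw : Measurable[M.ℱ 0] fun _ : Ω => w := measurable_const
  have hcost : ∀ s ∈ M.admissible n, ((1 / M.γ : ℝ) : EReal) * ENNReal.log (∫⁻ ω, ENNReal.ofReal
      (Real.exp (M.γ * M.reducedCost w.1 n q z s ω)) ∂P) = M.certEquiv (∫⁻ ω, ENNReal.ofReal
        (Real.exp (M.γ * M.totalCost n q z (fun _ => w) s ω)) ∂P) := by
    intro s hs
    simp only [M.reducedCost_eq hn q z w hs, certEquiv]
  refine le_antisymm ?_ (le_iInf₂ fun s hs => ?_)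
  · have hs := M.optimalStrategy_mem_admissible (q := q) (z := z) hnN hw
    refine (iInf₂_le _ hs).trans ?_
    rw [hcost _ hs, certEquiv_le_iff]
    have h := M.lintegral_le_expValue hnN hw hs
      (ae_of_all _ (M.optimalStrategy_obeysValue (q := q) (z := z) hnN))
    simpa using h
  · rw [hcost s hs, certEquiv_le_iff]
    have h := M.lintegral_expValue_le (q := q) (z := z) hnN hw hs
    simpa using h

theorem stepCost_eq {n : ℕ} (hn : n < M.N) (w : VolumeCurve) (q z v : ℝ) :
    M.stepCost w.1 n q z v = M.certEquiv (M.expOrder n (w, q, z) v) := by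
  rw [stepCost, certEquiv, expOrder, expStep]
  congr 2
  refine lintegral_congr fun ω => ?_
  rw [M.theta_eq (by omega) (by omega), exp_mul_add_certEquiv]
  rfl

theorem ell_le_thetaTilde_iff {n : ℕ} (hn : n < M.N) (w : VolumeCurve) (q z : ℝ) :
    (M.ell q : EReal) ≤ M.thetaTilde w.1 n q z ↔
      M.expDelivery (w, q, z) ≤ M.expCont n (w, q, z) := by
  rw [M.ell_eq_certEquiv (w, q, z), thetaTilde, expCont, le_iInf_iff, le_iInf_iff]
  simp only [M.stepCost_eq hn, certEquiv_le_iff]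

theorem isMinOn_stepCost_iff {n : ℕ} (hn : n < M.N) (w : VolumeCurve) (q z v : ℝ) :
    IsMinOn (M.stepCost w.1 n q z) Set.univ v ↔
      M.expOrder n (w, q, z) v ≤ M.expCont n (w, q, z) := by
  rw [isMinOn_univ_iff, expCont, le_iInf_iff]
  simp only [M.stepCost_eq hn, certEquiv_le_iff]

/-- On the first day `Q - Q / 1 = 0` removes the innovation from the running cost, and the factor `0
/ 1` sends the spread to 0. What remains of `z` is a positive finite constant factor, which does not
affect minimisers. -/
theorem isMinOn_initialCost_iff (w : VolumeCurve) (z v : ℝ) :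
    IsMinOn (M.initialCost w.1) Set.univ v ↔
      M.expOrder 0 (w, M.Q, z) v ≤ M.expCont 0 (w, M.Q, z) := by
  obtain ⟨m, hm⟩ := M.deliveryDates_nonempty
  have hN : 1 ≤ M.N := by have := M.deliveryDates_mem m hm; omega
  have h1 : ∀ u, M.initialCost w.1 u = M.certEquiv (ENNReal.ofReal (Real.exp (M.γ *
      (M.L (u / w.1 1) * w.1 1 * M.δt))) * M.expValue 1 (w, M.Q - u * M.δt, 0)) := by
    intro u
    rw [certEquiv_eq_iff, initialCost, M.theta_eq le_rfl hN, exp_mul_add_certEquiv]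
  have h2 : ∀ u, M.expOrder 0 (w, M.Q, z) u =
      ENNReal.ofReal (Real.exp (M.γ * (M.σ * √M.δt * -(M.Q * z)))) *
        (ENNReal.ofReal (Real.exp (M.γ *
          (M.L (u / w.1 1) * w.1 1 * M.δt))) * M.expValue 1 (w, M.Q - u * M.δt, 0)) := by
    intro u
    rw [← mul_assoc, ← ENNReal.ofReal_mul (Real.exp_pos _).le, ← Real.exp_add, ← mul_add]
    simp [expOrder, expStep, runCost, nextState]
  rw [isMinOn_univ_iff, expCont, le_iInf_iff]
  simp only [h1, h2, certEquiv_le_iff]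
  refine forall_congr' fun u => (ENNReal.mul_le_mul_iff_right ?_ ENNReal.ofReal_ne_top).symm
  exact (ENNReal.ofReal_pos.2 (Real.exp_pos _)).ne'

theorem obeysFrom_iff {n : ℕ} {q S A : ℝ} {s : ASRStrategy Ω} {ω : Ω} :
    M.ObeysFrom n q S A s ω ↔ ∀ k, n ≤ k → 1 ≤ k → k < M.N → k ≤ s.nstar ω →
      (k ∈ M.deliveryDates → (s.nstar ω = k ↔
        M.expDelivery (M.stateAt n q (M.spreadAt n A S) M.volumeCurve s k ω) ≤
          M.expCont k (M.stateAt n q (M.spreadAt n A S) M.volumeCurve s k ω))) ∧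
      (k < s.nstar ω →
        M.expOrder k (M.stateAt n q (M.spreadAt n A S) M.volumeCurve s k ω) (s.v k ω) ≤
          M.expCont k (M.stateAt n q (M.spreadAt n A S) M.volumeCurve s k ω)) := by
  refine forall_congr' fun k => forall_congr' fun hnk => forall_congr' fun _ =>
    forall_congr' fun hk => ?_
  rw [M.spread_eq_spreadFrom hnk, M.spread_self]
  have h1 := M.ell_le_thetaTilde_iff hk (M.volumeCurve ω) (M.inventory n q s k ω)
    (M.spreadFrom n (M.spreadAt n A S) k ω)
  have h2 := M.isMinOn_stepCost_iff hk (M.volumeCurve ω) (M.inventory n q s k ω)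
    (M.spreadFrom n (M.spreadAt n A S) k ω) (s.v k ω)
  have h3 : (M.volumeCurve ω).1 = fun i => M.V i ω := rfl
  rw [h3] at h1 h2
  rw [h1, h2]
  rfl

theorem obeysFrom_iff_obeysValue {n : ℕ} (hn : 1 ≤ n) {q S A : ℝ} {s : ASRStrategy Ω} {ω : Ω} :
    M.ObeysFrom n q S A s ω ↔ M.ObeysValue n q (M.spreadAt n A S) M.volumeCurve s ω := by
  rw [obeysFrom_iff]
  exact forall_congr' fun k => forall_congr' fun hnk =>
    ⟨fun h => h (hn.trans hnk), fun h _ => h⟩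

/-- Time 0 is neither a delivery date nor the final date, so the clause `k = 0` of `ObeysValue` is
only about the order, which is what `ObeysAtZero` prescribes. -/
theorem obeysAtZero_and_obeysFrom_iff_obeysValue {S A : ℝ} {s : ASRStrategy Ω}
    (hs : s ∈ M.admissible 0) {ω : Ω} :
    M.ObeysAtZero s ω ∧ M.ObeysFrom 0 M.Q S A s ω ↔
      M.ObeysValue 0 M.Q (M.spreadAt 0 A S) M.volumeCurve s ω := by
  have hN : 0 < M.N := by
    obtain ⟨m, hm⟩ := M.deliveryDates_nonempty
    have := M.deliveryDates_mem m hm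
    omega
  have h0 : 0 ∉ M.deliveryDates := fun h => by
    have := M.deliveryDates_mem 0 h
    omega
  have hpos : 0 < s.nstar ω := by
    refine Nat.pos_of_ne_zero fun h => ?_
    rcases (hs.2.2 ω).1 with h' | h'
    · exact h0 (h ▸ h')
    · omega
  have h1 := M.isMinOn_initialCost_iff (M.volumeCurve ω) (M.spreadAt 0 A S) (s.v 0 ω)
  rw [← M.stateAt_self (w := M.volumeCurve) (s := s) ω] at h1
  rw [obeysFrom_iff]
  refine ⟨fun ⟨ha, hb⟩ k _ hk hle => ?_, fun h => ⟨?_, fun k hk _ => h k hk⟩⟩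
  · rcases Nat.eq_zero_or_pos k with rfl | hk0
    · exact ⟨fun h => absurd h h0, fun _ => h1.1 ha⟩
    · exact hb k (Nat.zero_le k) hk0 hk hle
  · exact h1.2 ((h 0 le_rfl hN (Nat.zero_le _)).2 hpos)

/-! ### Optimality -/

/-- Expected utility is minus a positive constant times the expected exponential of `totalCost`. The
expectation of `expValue` at the initial state bounds the latter from below for every competitor and
from above for `s`. -/
theorem isMaxOn_expectedUtility {n : ℕ} (hn : n ≤ M.N) (x q S A : ℝ) {s : ASRStrategy Ω}
    (hs : s ∈ M.admissible n)
    (ho : ∀ᵐ ω ∂P, M.ObeysValue n q (M.spreadAt n A S) M.volumeCurve s ω) :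
    IsMaxOn (M.expectedUtility n x q S A) (M.admissible n) s := by
  have h : ∀ r ∈ M.admissible n, M.expectedUtility n x q S A r =
      -((ENNReal.ofReal (Real.exp (M.γ * (x + q * S - M.Q * ((n : ℝ) / n * A)))) *
        ∫⁻ ω, ENNReal.ofReal (Real.exp (M.γ *
          M.totalCost n q (M.spreadAt n A S) M.volumeCurve r ω)) ∂P : ℝ≥0∞) : EReal) := by
    intro r hr
    rw [expectedUtility, ← lintegral_const_mul' _ _ ENNReal.ofReal_ne_top]
    congr 2
    refine lintegral_congr fun ω => ?_
    rw [← ENNReal.ofReal_mul (Real.exp_pos _).le, ← Real.exp_add, ← mul_add,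
      ← M.wealth_eq n x q S A hr ω]
    congr 2
    ring
  intro r hr
  rw [Set.mem_ofPred_eq, h r hr, h s hs, EReal.neg_le_neg_iff, EReal.coe_ennreal_le_coe_ennreal_iff]
  exact mul_le_mul_right ((M.lintegral_le_expValue hn M.measurable_volumeCurve hs ho).trans
    (M.lintegral_expValue_le hn M.measurable_volumeCurve hr)) _

end ASRModel

end

theorem mainTheorem4 {Ω : Type*} [MeasurableSpace Ω] (P : Measure Ω) [IsProbabilityMeasure P]
    (M : ASRModel P) :
    -- the problem at inception
    ((∃ s ∈ M.admissible 0, ∀ ω, M.ObeysAtZero s ω ∧ M.ObeysFrom 0 M.Q M.S₀ 0 s ω) ∧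
      (∀ s ∈ M.admissible 0,
        (∀ᵐ ω ∂P, M.ObeysAtZero s ω ∧ M.ObeysFrom 0 M.Q M.S₀ 0 s ω) →
        IsMaxOn (M.expectedUtility 0 0 M.Q M.S₀ 0) (M.admissible 0) s)) ∧
    -- the problem at an intermediate time, from an arbitrary state
    (∀ n, 1 ≤ n → n < M.N → ∀ x q S A : ℝ,
      (∃ s ∈ M.admissible n, ∀ ω, M.ObeysFrom n q S A s ω) ∧
      (∀ s ∈ M.admissible n, (∀ᵐ ω ∂P, M.ObeysFrom n q S A s ω) →
        IsMaxOn (M.expectedUtility n x q S A) (M.admissible n) s)) := by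
  refine ⟨⟨?_, fun s hs ho => ?_⟩, fun n hn hnN x q S A => ⟨?_, fun s hs ho => ?_⟩⟩
  · have hs := M.optimalStrategy_mem_admissible (q := M.Q) (z := M.spreadAt 0 0 M.S₀)
      (Nat.zero_le _) M.measurable_volumeCurve
    exact ⟨_, hs, fun ω => (M.obeysAtZero_and_obeysFrom_iff_obeysValue hs).2
      (M.optimalStrategy_obeysValue (Nat.zero_le _) ω)⟩
  · exact M.isMaxOn_expectedUtility (Nat.zero_le _) 0 M.Q M.S₀ 0 hs
      (ho.mono fun ω h => (M.obeysAtZero_and_obeysFrom_iff_obeysValue hs).1 h)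
  · exact ⟨_, M.optimalStrategy_mem_admissible hnN.le M.measurable_volumeCurve,
      fun ω => (M.obeysFrom_iff_obeysValue hn).2 (M.optimalStrategy_obeysValue hnN.le ω)⟩
  · exact M.isMaxOn_expectedUtility hnN.le x q S A hs
      (ho.mono fun ω h => (M.obeysFrom_iff_obeysValue hn).1 h)
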